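/- Let $m\ge 2$ be a fixed integer. Consider a sequence of problems with $N\to\infty$, in which $1\le n<N$ and $0<p_0<p_1<1$ may all vary along the sequence, and $p_0,p_1$ are known. Under $H_0$ (law $\mathbb P_0$) one observes a random $m$-uniform hypergraph on $\{1,\dots,N\}$ in which every $m$-subset of vertices is an edge independently with probability $p_0$. Under $H_1$ there is an unknown set $S$ of $n$ vertices such that (law $\mathbb P_S$) all $m$-subsets are edges independently, with probability $p_1$ for the $m$-subsets contained in $S$ and $p_0$ for all others. The risk of a test $T$ (a $\{0,1\}$-valued function of the hypergraph, $T=1$ meaning that $H_0$ is rejected) is $$\gamma_N(T)=\mathbb P_0(T=1)+\max_{|S|=n}\mathbb P_S(T=0).$$ Let $H_p(q)=q\log\frac qp+(1-q)\log\frac{1-q}{1-p}$. Assume that $p_0$ is bounded away from $1$, i.e. $\limsup p_0<1$, and that $$\frac{\log N}{n^{m-1}}=o(1),\qquad \log\Bigl(1\vee\frac1{n^{m-1}p_0}\Bigr)=o\Bigl(\log\frac Nn\Bigr).$$ If $$\frac{p_1-p_0}{\sqrt{p_0}}\Bigl(\frac{n^2}{N}\Bigr)^{m/2}\to0\qquad\text{and}\qquad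 \limsup\frac{(n-1)(n-2)\cdots(n-m+1)\,H_{p_0}(p_1)}{m!\,\log\frac Nn}<1,$$ then all tests are asymptotically powerless: no sequence of tests does asymptotically better than the trivial tests, which have risk $1$. That is, $\inf_T\gamma_N(T)\to1$; equivalently, $\liminf\gamma_N(T_N)\ge1$ for every sequence of tests $T_N$. In particular $\gamma_N(T_N)\to1$ for every sequence of tests with $\gamma_N(T_N)\le1$ eventually. -/

import Mathlib

open Filter Topology MeasureTheory Asymptotics

noncomputable section

namespace DenseSubhypergraph

/-- Potential edges of an `m`-uniform hypergraph on `N` vertices: the `m`-element vertex sets. -/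
abbrev Edge (m N : ℕ) : Type := {e : Finset (Fin N) // e.card = m}

/-- An `m`-uniform hypergraph on `N` vertices, through its adjacency array: `A e = true` if and
only if `e` is an edge. -/
abbrev Hypergraph (m N : ℕ) : Type := Edge m N → Bool

/-- The Erdős–Rényi law: every potential edge is present with probability `p₀`, independently. -/
def nullLaw (m N : ℕ) (p₀ : unitInterval) : Measure (Hypergraph m N) :=
  Measure.pi fun _ => ProbabilityTheory.bernoulliMeasure true false p₀

/-- The law with a subhypergraph planted on `S`: the potential edges are independent, those
contained in `S` are present with probability `p₁`, all others with probability `p₀`. -/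
def plantedLaw (m N : ℕ) (p₀ p₁ : unitInterval) (S : Finset (Fin N)) :
    Measure (Hypergraph m N) :=
  Measure.pi fun e => ProbabilityTheory.bernoulliMeasure true false
    (if e.1 ⊆ S then p₁ else p₀)

/-- A test is a 0-1 valued function of the hypergraph; the value `true` means that the null
hypothesis is rejected. -/
abbrev Test (m N : ℕ) : Type := Hypergraph m N → Bool

/-- The risk `ℙ₀(T = 1) + max_{|S| = n} ℙ_S(T = 0)` of a test. -/
def risk (m N n : ℕ) (p₀ p₁ : unitInterval) (T : Test m N) : ℝ :=
  (nullLaw m N p₀).real {A | T A = true} +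
    ⨆ S : {S : Finset (Fin N) // S.card = n},
      (plantedLaw m N p₀ p₁ S.1).real {A | T A = false}

/-- `H_p(q)`, the Kullback–Leibler divergence of the Bernoulli law of parameter `q` from that of
parameter `p`. -/
def bernoulliKL (p q : ℝ) : ℝ :=
  q * Real.log (q / p) + (1 - q) * Real.log ((1 - q) / (1 - p))

end DenseSubhypergraph

end

/-! The maximum over planted sets is at least the average under a uniform prior, so it suffices that
the averaged likelihood ratio `Q` is close to 1 in L² under the null. The plain second moment is a
sum over the overlap size k = |S ∩ S'|, with terms (1 + χ)^(k choose m), χ = (p₁ - p₀)² / (p₀(1 -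
p₀)), and it can blow up at large overlaps because of rare hypergraphs. Hence each ratio is cut off
where some nonempty T ⊆ S has likelihood ratio above exp(B |T|), with B k = k(1 - ε/2)L and L =
log(N/n). An overlap of size k then costs at most the minimum of (1 + χ)^(k choose m) and exp(B k)
(`sum_truncatedRatio_mul_le_exp`).

Three facts remain. The cutoff keeps almost all the planted mass: a Chernoff bound with a
Poisson-type moment estimate, summed over T, works because the scan condition puts the mean log
ratio on k vertices below k(1 - ε)L (`tail_bound`). Overlaps beyond a constant times n²/N are rare
enough to pay for the minimum above (`overlap_bound`). For smaller overlaps the degree condition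
makes (1 + χ)^(k choose m) nearly 1 (`one_add_pow_choose_le`).

The rate conditions make the log odds ratio θ of the two edge probabilities at most a small multiple
of L when L is large, which both estimates need. When L is bounded, n itself is of order n²/N and
the untruncated second moment suffices. -/

noncomputable section

namespace DenseSubhypergraph

/-! ### Product Bernoulli laws and moments of likelihood ratios -/

section FiniteProduct

variable {E : Type*}

/-- The mass function of the Bernoulli law of parameter `p` on `Bool`. -/
def bernoulliWeight (p : ℝ) (b : Bool) : ℝ := cond b p (1 - p)

/-- The likelihood ratio of the Bernoulli law of parameter `p₁` to that of parameter `p₀`. -/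
def bernoulliRatio (p₀ p₁ : ℝ) (b : Bool) : ℝ := cond b (p₁ / p₀) ((1 - p₁) / (1 - p₀))

/-- The mass function of the product of Bernoulli laws of parameter `p`. -/
def nullWeight [Fintype E] (p : ℝ) (A : E → Bool) : ℝ := ∏ e, bernoulliWeight p (A e)

/-- The likelihood ratio when the parameter is raised from `p₀` to `p₁` on the coordinates
in `F`. -/
def likelihoodRatio (p₀ p₁ : ℝ) (F : Finset E) (A : E → Bool) : ℝ :=
  ∏ e ∈ F, bernoulliRatio p₀ p₁ (A e)

lemma sum_prod_bool [Fintype E] [DecidableEq E] (f : E → Bool → ℝ) :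
    ∑ A : E → Bool, ∏ e, f e (A e) = ∏ e, (f e true + f e false) := by
  have h := Finset.prod_univ_sum (fun _ : E => (Finset.univ : Finset Bool)) f
  simp only [Fintype.piFinset_univ, Fintype.sum_bool] at h
  exact h.symm

lemma nullWeight_nonneg [Fintype E] {p : ℝ} (h0 : 0 ≤ p) (h1 : p ≤ 1) (A : E → Bool) :
    0 ≤ nullWeight p A :=
  Finset.prod_nonneg fun e _ => by
    rcases A e <;> simp only [bernoulliWeight, cond_true, cond_false] <;> linarith

lemma likelihoodRatio_pos {p₀ p₁ : ℝ} (h0 : 0 < p₀) (h01 : p₀ < p₁) (h1 : p₁ < 1)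
    (F : Finset E) (A : E → Bool) : 0 < likelihoodRatio p₀ p₁ F A :=
  Finset.prod_pos fun e _ => by
    rcases A e <;> simp only [bernoulliRatio, cond_true, cond_false] <;>
      apply div_pos <;> linarith

lemma likelihoodRatio_mul [DecidableEq E] (p₀ p₁ : ℝ) (F G : Finset E) (A : E → Bool) :
    likelihoodRatio p₀ p₁ F A * likelihoodRatio p₀ p₁ G A =
      likelihoodRatio p₀ p₁ (F ∩ G) A * likelihoodRatio p₀ p₁ (F ∪ G) A := by
  unfold likelihoodRatio
  rw [← Finset.prod_union_inter, mul_comm]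

/-- Change of measure: coordinates outside `G` integrate to 1, and those in `G` see the raised
parameter. Total mass, second moment and Chernoff moments are all instances. -/
lemma sum_nullWeight_mul_likelihoodRatio_mul_prod [Fintype E] [DecidableEq E]
    {p₀ p₁ : ℝ} (h0 : 0 < p₀) (h01 : p₀ < p₁)
    (h1 : p₁ < 1) {F G : Finset E} (hGF : G ⊆ F) (g : Bool → ℝ) :
    ∑ A : E → Bool, nullWeight p₀ A * (likelihoodRatio p₀ p₁ F A * ∏ e ∈ G, g (A e)) =
      (p₁ * g true + (1 - p₁) * g false) ^ G.card := by
  have key : ∀ A : E → Bool,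
      nullWeight p₀ A * (likelihoodRatio p₀ p₁ F A * ∏ e ∈ G, g (A e)) =
      ∏ e, (fun (e : E) (b : Bool) => bernoulliWeight p₀ b *
        ((if e ∈ F then bernoulliRatio p₀ p₁ b else 1) * (if e ∈ G then g b else 1))) e (A e) := by
    intro A
    unfold nullWeight likelihoodRatio
    rw [Finset.prod_mul_distrib, Finset.prod_mul_distrib, Finset.prod_ite_mem,
      Finset.prod_ite_mem, Finset.univ_inter, Finset.univ_inter]
  rw [Finset.sum_congr rfl fun A _ => key A, sum_prod_bool (fun (e : E) (b : Bool) =>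
    bernoulliWeight p₀ b * ((if e ∈ F then bernoulliRatio p₀ p₁ b else 1) *
      (if e ∈ G then g b else 1)))]
  have h2 : ∀ e : E, (bernoulliWeight p₀ true *
        ((if e ∈ F then bernoulliRatio p₀ p₁ true else 1) * (if e ∈ G then g true else 1))) +
      (bernoulliWeight p₀ false *
        ((if e ∈ F then bernoulliRatio p₀ p₁ false else 1) * (if e ∈ G then g false else 1))) =
      if e ∈ G then (p₁ * g true + (1 - p₁) * g false) else 1 := by
    intro e
    have hp : p₀ ≠ 0 := h0.ne'
    have hq : 1 - p₀ ≠ 0 := by linarith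
    simp only [bernoulliWeight, bernoulliRatio, cond_true, cond_false]
    by_cases hG : e ∈ G
    · simp only [hG, hGF hG, if_true]
      field_simp
    · by_cases hF : e ∈ F
      · simp only [hG, hF, if_true, if_false]
        field_simp
        ring
      · simp only [hG, hF, if_false]
        ring
  rw [Finset.prod_congr rfl fun e _ => h2 e, Finset.prod_ite_mem, Finset.univ_inter,
    Finset.prod_const]

lemma sum_nullWeight_mul_likelihoodRatio [Fintype E] [DecidableEq E]
    {p₀ p₁ : ℝ} (h0 : 0 < p₀) (h01 : p₀ < p₁)
    (h1 : p₁ < 1) (F : Finset E) :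
    ∑ A : E → Bool, nullWeight p₀ A * likelihoodRatio p₀ p₁ F A = 1 := by
  simpa using sum_nullWeight_mul_likelihoodRatio_mul_prod h0 h01 h1 (Finset.empty_subset F)
    (fun _ => (1 : ℝ))

lemma sum_nullWeight [Fintype E] [DecidableEq E] (p : ℝ) : ∑ A : E → Bool, nullWeight p A = 1 := by
  unfold nullWeight
  rw [sum_prod_bool (fun _ b => bernoulliWeight p b)]
  simp [bernoulliWeight]

/-- The product of the ratios on `F` and `G` is the ratio on `F ∪ G`, a change of measure, times the
ratio on `F ∩ G`. Each common coordinate thus contributes the mean ratio under the raised parameter,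
1 plus the chi-square divergence. -/
lemma sum_nullWeight_mul_likelihoodRatio_mul_likelihoodRatio [Fintype E] [DecidableEq E]
    {p₀ p₁ : ℝ} (h0 : 0 < p₀)
    (h01 : p₀ < p₁) (h1 : p₁ < 1) (F G : Finset E) :
    ∑ A : E → Bool, nullWeight p₀ A * (likelihoodRatio p₀ p₁ F A * likelihoodRatio p₀ p₁ G A) =
      (1 + (p₁ - p₀) ^ 2 / (p₀ * (1 - p₀))) ^ (F ∩ G).card := by
  have h := sum_nullWeight_mul_likelihoodRatio_mul_prod h0 h01 h1
    (Finset.inter_subset_union (s := F) (t := G)) (bernoulliRatio p₀ p₁)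
  have hp : p₀ ≠ 0 := h0.ne'
  have hq : 1 - p₀ ≠ 0 := by linarith
  have e : p₁ * bernoulliRatio p₀ p₁ true + (1 - p₁) * bernoulliRatio p₀ p₁ false =
      1 + (p₁ - p₀) ^ 2 / (p₀ * (1 - p₀)) := by
    simp only [bernoulliRatio, cond_true, cond_false]
    field_simp
    ring
  rw [e] at h
  rw [← h]
  refine Finset.sum_congr rfl fun A _ => ?_
  rw [likelihoodRatio_mul, mul_comm (likelihoodRatio p₀ p₁ (F ∩ G) A)]
  rfl

end FiniteProduct

/-! ### From the risk to a second moment under the uniform prior -/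

section Risk

variable {m N : ℕ}

/-- The potential edges contained in a set of vertices. -/
def edgesIn (m : ℕ) {N : ℕ} (S : Finset (Fin N)) : Finset (Edge m N) :=
  Finset.univ.filter fun e => e.1 ⊆ S

lemma edgesIn_inter (S T : Finset (Fin N)) :
    edgesIn m (S ∩ T) = edgesIn m S ∩ edgesIn m T := by
  ext e
  simp [edgesIn, Finset.subset_inter_iff]

lemma edgesIn_mono {S T : Finset (Fin N)} (h : S ⊆ T) : edgesIn m S ⊆ edgesIn m T := by
  intro e he
  simp only [edgesIn, Finset.mem_filter, Finset.mem_univ, true_and] at he ⊢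
  exact he.trans h

lemma card_edgesIn (S : Finset (Fin N)) : (edgesIn m S).card = S.card.choose m := by
  rw [← Finset.card_powersetCard]
  refine Finset.card_bij (fun e _ => e.1) ?_ ?_ ?_
  · intro e he
    simp only [edgesIn, Finset.mem_filter, Finset.mem_univ, true_and] at he
    exact Finset.mem_powersetCard.2 ⟨he, e.2⟩
  · intro a _ b _ h
    exact Subtype.ext h
  · intro b hb
    obtain ⟨h1, h2⟩ := Finset.mem_powersetCard.1 hb
    exact ⟨⟨b, h2⟩, by simpa [edgesIn] using h1, rfl⟩

lemma bernoulliMeasure_real_singleton (p : unitInterval) (b : Bool) :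
    (ProbabilityTheory.bernoulliMeasure true false p).real {b} = bernoulliWeight p b := by
  cases b
  · rw [ProbabilityTheory.bernoulliMeasure_real_apply_of_notMem_of_mem] <;>
      simp [bernoulliWeight]
  · rw [ProbabilityTheory.bernoulliMeasure_real_apply_of_mem_of_notMem] <;>
      simp [bernoulliWeight]

lemma pi_bernoulliMeasure_real_setOf {E : Type*} [Fintype E] [DecidableEq E]
    (p : E → unitInterval) (P : (E → Bool) → Prop) [DecidablePred P] :
    (Measure.pi fun e => ProbabilityTheory.bernoulliMeasure true false (p e)).real {A | P A} =
      ∑ A, if P A then ∏ e, bernoulliWeight (p e) (A e) else 0 := by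
  have : {A | P A} = ((Finset.univ.filter P : Finset (E → Bool)) : Set (E → Bool)) := by
    ext; simp
  rw [this, ← sum_measureReal_singleton, Finset.sum_filter]
  refine Finset.sum_congr rfl fun A _ => ?_
  congr 1
  rw [measureReal_def, Measure.pi_singleton, ENNReal.toReal_prod]
  exact Finset.prod_congr rfl fun e _ => bernoulliMeasure_real_singleton (p e) (A e)

lemma nullLaw_real_setOf (p₀ : unitInterval) (P : Hypergraph m N → Prop) [DecidablePred P] :
    (nullLaw m N p₀).real {A | P A} = ∑ A, if P A then nullWeight (p₀ : ℝ) A else 0 :=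
  pi_bernoulliMeasure_real_setOf (fun _ => p₀) P

lemma plantedLaw_real_setOf {p₀ p₁ : unitInterval} (h0 : 0 < (p₀ : ℝ)) (h1 : (p₀ : ℝ) < 1)
    (S : Finset (Fin N)) (P : Hypergraph m N → Prop) [DecidablePred P] :
    (plantedLaw m N p₀ p₁ S).real {A | P A} =
      ∑ A, if P A then nullWeight (p₀ : ℝ) A * likelihoodRatio (p₀ : ℝ) p₁ (edgesIn m S) A
        else 0 := by
  unfold plantedLaw
  rw [pi_bernoulliMeasure_real_setOf (fun e : Edge m N => if e.1 ⊆ S then p₁ else p₀) P]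
  refine Finset.sum_congr rfl fun A _ => ?_
  congr 1
  unfold nullWeight likelihoodRatio edgesIn
  rw [Finset.prod_filter, ← Finset.prod_mul_distrib]
  refine Finset.prod_congr rfl fun e _ => ?_
  have hp : (p₀ : ℝ) ≠ 0 := h0.ne'
  have hq : 1 - (p₀ : ℝ) ≠ 0 := by linarith
  by_cases h : e.1 ⊆ S
  · simp only [h, if_true]
    cases A e <;> simp only [bernoulliWeight, bernoulliRatio, cond_true, cond_false] <;> field_simp
  · simp [h]

lemma risk_ge_bayes {n : ℕ} {p₀ p₁ : unitInterval} (h0 : 0 < (p₀ : ℝ)) (h1 : (p₀ : ℝ) < 1)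
    (hn : n ≤ N) (T : Test m N) :
    ∑ A, (if T A = true then nullWeight (p₀ : ℝ) A else 0) +
      (∑ S ∈ Finset.powersetCard n (Finset.univ : Finset (Fin N)),
        ∑ A, if T A = false then
          nullWeight (p₀ : ℝ) A * likelihoodRatio (p₀ : ℝ) p₁ (edgesIn m S) A else 0) /
        (N.choose n : ℝ) ≤ risk m N n p₀ p₁ T := by
  unfold risk
  rw [nullLaw_real_setOf p₀ (fun A => T A = true)]
  refine add_le_add le_rfl ?_
  have hpos : (0 : ℝ) < N.choose n := by exact_mod_cast Nat.choose_pos hn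
  rw [div_le_iff₀ hpos]
  have hb : BddAbove (Set.range fun S : {S : Finset (Fin N) // S.card = n} =>
      (plantedLaw m N p₀ p₁ S.1).real {A | T A = false}) := Set.finite_range _ |>.bddAbove
  calc _ ≤ ∑ _S ∈ Finset.powersetCard n (Finset.univ : Finset (Fin N)),
        ⨆ S : {S : Finset (Fin N) // S.card = n},
          (plantedLaw m N p₀ p₁ S.1).real {A | T A = false} := by
        refine Finset.sum_le_sum fun S hS => ?_
        rw [← plantedLaw_real_setOf h0 h1 S (fun A => T A = false)]
        exact le_ciSup hb ⟨S, (Finset.mem_powersetCard.1 hS).2⟩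
    _ = _ := by
        rw [Finset.sum_const, Finset.card_powersetCard, Finset.card_univ, Fintype.card_fin,
          nsmul_eq_mul, mul_comm]

lemma risk_const_false {n : ℕ} (hn : n ≤ N) (p₀ p₁ : unitInterval) :
    risk m N n p₀ p₁ (fun _ => false) = 1 := by
  have : Nonempty {S : Finset (Fin N) // S.card = n} := by
    obtain ⟨S, _, hS⟩ := Finset.exists_subset_card_eq
      (s := (Finset.univ : Finset (Fin N))) (n := n) (by simpa using hn)
    exact ⟨⟨S, hS⟩⟩
  have h : ∀ S : Finset (Fin N), (plantedLaw m N p₀ p₁ S).real Set.univ = 1 := by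
    intro S
    unfold plantedLaw
    exact probReal_univ
  simp [risk, h]

/-- The truncated second moment bound: if the likelihood ratios have truncations that keep most of
the mass and whose second moment under a uniform prior is nearly one, then no test does
much better than the trivial ones. -/
lemma risk_ge_of_truncated_second_moment {n : ℕ} {p₀ p₁ : unitInterval} (h0 : 0 < (p₀ : ℝ))
    (h01 : (p₀ : ℝ) < p₁) (h1 : (p₁ : ℝ) < 1) (hn : n ≤ N)
    (M : Finset (Fin N) → Hypergraph m N → ℝ)
    (hM : ∀ S A, M S A ≤ likelihoodRatio (p₀ : ℝ) p₁ (edgesIn m S) A)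
    {τ σ c : ℝ} (hc : 0 < c)
    (hmass : ∀ S : Finset (Fin N), S.card = n → 1 - τ ≤ ∑ A, nullWeight (p₀ : ℝ) A * M S A)
    (hsecond : ∀ S : Finset (Fin N), S.card = n →
      ∑ S' ∈ Finset.powersetCard n (Finset.univ : Finset (Fin N)),
        ∑ A, nullWeight (p₀ : ℝ) A * (M S A * M S' A) ≤ (N.choose n : ℝ) * (1 + σ))
    (hστ : σ + 2 * τ ≤ c ^ 2) (T : Test m N) :
    1 - c ≤ risk m N n p₀ p₁ T := by
  set U := Finset.powersetCard n (Finset.univ : Finset (Fin N)) with hU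
  set C : ℝ := (N.choose n : ℝ) with hC
  have hCpos : 0 < C := by rw [hC]; exact_mod_cast Nat.choose_pos hn
  have hUcard : (U.card : ℝ) = C := by
    rw [hU, Finset.card_powersetCard, Finset.card_univ, Fintype.card_fin]
  have hmemU : ∀ S ∈ U, S.card = n := fun S hS => (Finset.mem_powersetCard.1 hS).2
  set w : Hypergraph m N → ℝ := nullWeight (p₀ : ℝ) with hw
  have hwnn : ∀ A, 0 ≤ w A := fun A => nullWeight_nonneg h0.le (by linarith) A
  have hw1 : ∑ A, w A = 1 := sum_nullWeight (p₀ : ℝ)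
  set Q : Hypergraph m N → ℝ := fun A => (∑ S ∈ U, M S A) / C with hQ
  have hQ1 : 1 - τ ≤ ∑ A, w A * Q A := by
    have : ∑ A, w A * Q A = (∑ S ∈ U, ∑ A, w A * M S A) / C := by
      rw [Finset.sum_comm, Finset.sum_div]
      refine Finset.sum_congr rfl fun A _ => ?_
      rw [← Finset.mul_sum, hQ, mul_div_assoc]
    rw [this, le_div_iff₀ hCpos]
    calc (1 - τ) * C = ∑ _S ∈ U, (1 - τ) := by
          rw [Finset.sum_const, nsmul_eq_mul, hUcard, mul_comm]
      _ ≤ _ := Finset.sum_le_sum fun S hS => hmass S (hmemU S hS)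
  have hQ2 : ∑ A, w A * Q A ^ 2 ≤ 1 + σ := by
    have : ∑ A, w A * Q A ^ 2 = (∑ S ∈ U, ∑ S' ∈ U, ∑ A, w A * (M S A * M S' A)) / C ^ 2 := by
      have e : ∑ S ∈ U, ∑ S' ∈ U, ∑ A, w A * (M S A * M S' A) =
          ∑ A, w A * (∑ S ∈ U, M S A) ^ 2 := by
        calc _ = ∑ S ∈ U, ∑ A, ∑ S' ∈ U, w A * (M S A * M S' A) :=
              Finset.sum_congr rfl fun S _ => Finset.sum_comm
          _ = ∑ A, ∑ S ∈ U, ∑ S' ∈ U, w A * (M S A * M S' A) := Finset.sum_comm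
          _ = _ := Finset.sum_congr rfl fun A _ => by
              rw [sq, Finset.sum_mul_sum, Finset.mul_sum]
              exact Finset.sum_congr rfl fun S _ => by rw [Finset.mul_sum]
      rw [e, Finset.sum_div]
      refine Finset.sum_congr rfl fun A _ => ?_
      rw [hQ, div_pow, mul_div_assoc]
    rw [this, div_le_iff₀ (by positivity)]
    calc _ ≤ ∑ _S ∈ U, C * (1 + σ) := Finset.sum_le_sum fun S hS => hsecond S (hmemU S hS)
      _ = (1 + σ) * C ^ 2 := by
          rw [Finset.sum_const, nsmul_eq_mul, hUcard]; ring
  -- Expanding the square gives at most (1 + σ) - 2(1 - τ) + 1 = σ + 2τ.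
  have hV : ∑ A, w A * (Q A - 1) ^ 2 ≤ c ^ 2 := by
    have : ∑ A, w A * (Q A - 1) ^ 2 = ∑ A, w A * Q A ^ 2 - 2 * ∑ A, w A * Q A + ∑ A, w A := by
      rw [Finset.mul_sum, ← Finset.sum_sub_distrib, ← Finset.sum_add_distrib]
      exact Finset.sum_congr rfl fun A _ => by ring
    rw [this, hw1]
    linarith
  refine le_trans ?_ (risk_ge_bayes h0 (h01.trans h1) hn T)
  have hswap : (∑ S ∈ U, ∑ A, if T A = false then
      w A * likelihoodRatio (p₀ : ℝ) p₁ (edgesIn m S) A else 0) / C ≥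
      ∑ A, if T A = false then w A * Q A else 0 := by
    rw [ge_iff_le, le_div_iff₀ hCpos, Finset.sum_comm, Finset.sum_mul]
    refine Finset.sum_le_sum fun A _ => ?_
    by_cases hT : T A = false
    · simp only [hT, if_true]
      rw [← Finset.mul_sum, mul_assoc]
      refine mul_le_mul_of_nonneg_left ?_ (hwnn A)
      rw [hQ, div_mul_cancel₀ _ hCpos.ne']
      exact Finset.sum_le_sum fun S _ => hM S A
    · simp [hT]
  have hfin : 1 - c ≤ ∑ A, (if T A = true then w A else 0) +
      ∑ A, if T A = false then w A * Q A else 0 := by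
    rw [← Finset.sum_add_distrib]
    -- AM-GM in place of Cauchy–Schwarz: |Q - 1| ≤ ((Q - 1)²/c + c)/2, whose mean is at most c.
    have hle : ∀ A, w A - (w A * (Q A - 1) ^ 2 / c + w A * c) / 2 ≤
        (if T A = true then w A else 0) + if T A = false then w A * Q A else 0 := by
      intro A
      have hsq : 0 ≤ w A * (Q A - 1) ^ 2 / c :=
        div_nonneg (mul_nonneg (hwnn A) (sq_nonneg _)) hc.le
      cases hT : T A
      · simp only [if_true, Bool.false_eq_true, if_false, zero_add]
        have : 0 ≤ w A * ((Q A - 1) + c) ^ 2 / c :=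
          div_nonneg (mul_nonneg (hwnn A) (sq_nonneg _)) hc.le
        have e : w A * ((Q A - 1) + c) ^ 2 / c =
            w A * (Q A - 1) ^ 2 / c + 2 * (w A * (Q A - 1)) + w A * c := by
          field_simp
          ring
        rw [e] at this
        linarith
      · simp only [if_true, Bool.true_eq_false, if_false, add_zero]
        have := mul_nonneg (hwnn A) hc.le
        linarith
    refine le_trans ?_ (Finset.sum_le_sum fun A _ => hle A)
    rw [Finset.sum_sub_distrib, ← Finset.sum_div, Finset.sum_add_distrib, ← Finset.sum_div,
      ← Finset.sum_mul, hw1]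
    have : (∑ A, w A * (Q A - 1) ^ 2) / c ≤ c := by
      rw [div_le_iff₀ hc]; linarith [hV, sq c]
    linarith
  linarith

end Risk

/-! ### Overlap counts and the truncated likelihood ratio -/

section Truncation

variable {m N : ℕ}

lemma card_filter_superset_le (n : ℕ) (T : Finset (Fin N)) :
    ((Finset.powersetCard n (Finset.univ : Finset (Fin N))).filter fun S => T ⊆ S).card ≤
      (N - T.card).choose (n - T.card) := by
  have : (N - T.card).choose (n - T.card) =
      (Finset.powersetCard (n - T.card) (Finset.univ \ T : Finset (Fin N))).card := by
    rw [Finset.card_powersetCard, Finset.card_sdiff_of_subset (Finset.subset_univ T),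
      Finset.card_univ, Fintype.card_fin]
  rw [this]
  refine Finset.card_le_card_of_injOn (fun S => S \ T) ?_ ?_
  · intro S hS
    obtain ⟨hS, hT⟩ := Finset.mem_filter.1 hS
    refine Finset.mem_powersetCard.2
      ⟨Finset.sdiff_subset_sdiff (Finset.subset_univ S) subset_rfl, ?_⟩
    rw [Finset.card_sdiff_of_subset hT, (Finset.mem_powersetCard.1 hS).2]
  · intro S hS S' hS' h
    have h1 := (Finset.mem_filter.1 hS).2
    have h2 := (Finset.mem_filter.1 hS').2
    rw [← Finset.sdiff_union_of_subset h1, ← Finset.sdiff_union_of_subset h2]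
    exact congrArg (· ∪ T) h

/-- A uniform `n`-subset contains k given points with probability at most (n/N)^k, since each
successive factor (n - j)/(N - j) is at most n/N. -/
lemma choose_sub_mul_pow_le {n : ℕ} (hn : n ≤ N) {k : ℕ} (hk : k ≤ n) :
    (N - k).choose (n - k) * N ^ k ≤ N.choose n * n ^ k := by
  induction k with
  | zero => simp
  | succ k ih =>
    have ih := ih (by omega)
    obtain ⟨a, ha⟩ : ∃ a, N - k = a + 1 := ⟨N - k - 1, by omega⟩
    obtain ⟨b, hb⟩ : ∃ b, n - k = b + 1 := ⟨n - k - 1, by omega⟩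
    have h1 := Nat.add_one_mul_choose_eq a b
    rw [ha, hb] at ih
    have ha' : N - (k + 1) = a := by omega
    have hb' : n - (k + 1) = b := by omega
    rw [ha', hb']
    have h2 : (b + 1) * N ≤ n * (a + 1) := by
      have e1 : N = a + 1 + k := by omega
      have e2 : n = b + 1 + k := by omega
      have e3 : b ≤ a := by omega
      rw [e1, e2]
      nlinarith
    have hpos : 0 < a + 1 := by omega
    refine Nat.le_of_mul_le_mul_left ?_ hpos
    calc (a + 1) * (a.choose b * N ^ (k + 1))
        = (a + 1) * a.choose b * N ^ k * N := by ring
      _ = ((a + 1).choose (b + 1) * N ^ k) * ((b + 1) * N) := by rw [h1]; ring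
      _ ≤ (N.choose n * n ^ k) * (n * (a + 1)) := Nat.mul_le_mul ih h2
      _ = (a + 1) * (N.choose n * n ^ (k + 1)) := by ring

/-- A union bound replaces the hypergeometric law of the overlap: the term T = S ∩ S' is dominated
by the sum over all T ⊆ S with T ⊆ S'. -/
lemma sum_apply_card_inter_le {n : ℕ} (hn : n ≤ N) (h : ℕ → ℝ) (hh : ∀ k, 0 ≤ h k)
    {S : Finset (Fin N)} (hS : S.card = n) :
    ∑ S' ∈ Finset.powersetCard n (Finset.univ : Finset (Fin N)), h (S ∩ S').card ≤
      (N.choose n : ℝ) *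
        ∑ k ∈ Finset.range (n + 1), (n.choose k : ℝ) * (((n : ℝ) / N) ^ k * h k) := by
  calc _ ≤ ∑ S' ∈ Finset.powersetCard n (Finset.univ : Finset (Fin N)),
        ∑ T ∈ S.powerset, if T ⊆ S' then h T.card else 0 := by
        refine Finset.sum_le_sum fun S' _ => ?_
        have := Finset.single_le_sum (f := fun T : Finset (Fin N) => if T ⊆ S' then h T.card else 0)
          (s := S.powerset) (fun T _ => by
            split_ifs; exacts [hh _, le_rfl])
          (Finset.mem_powerset.2 (Finset.inter_subset_left (s₁ := S) (s₂ := S')))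
        simpa [Finset.inter_subset_right] using this
    _ = ∑ T ∈ S.powerset, ∑ S' ∈ Finset.powersetCard n (Finset.univ : Finset (Fin N)),
          if T ⊆ S' then h T.card else 0 := Finset.sum_comm
    _ ≤ ∑ T ∈ S.powerset, (N.choose n : ℝ) * (((n : ℝ) / N) ^ T.card * h T.card) := by
        refine Finset.sum_le_sum fun T hT => ?_
        rw [← Finset.sum_filter, Finset.sum_const, nsmul_eq_mul, ← mul_assoc]
        refine mul_le_mul_of_nonneg_right ?_ (hh _)
        have hTn : T.card ≤ n := hS ▸ Finset.card_le_card (Finset.mem_powerset.1 hT)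
        rcases Nat.eq_zero_or_pos N with h0 | h0
        · subst h0
          have hT0 : T.card = 0 := by omega
          have hn0 : n = 0 := by omega
          subst hn0
          have := card_filter_superset_le 0 T
          rw [hT0] at this ⊢
          simp
        · rw [div_pow, ← mul_div_assoc, le_div_iff₀ (by positivity)]
          calc _ ≤ ((N - T.card).choose (n - T.card) : ℝ) * (N : ℝ) ^ T.card := by
                gcongr
                exact card_filter_superset_le n T
            _ ≤ _ := by exact_mod_cast choose_sub_mul_pow_le hn hTn
    _ = _ := by
        rw [Finset.sum_powerset_apply_card
          (fun k => (N.choose n : ℝ) * (((n : ℝ) / N) ^ k * h k)), hS, Finset.mul_sum]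
        refine Finset.sum_congr rfl fun k _ => ?_
        rw [nsmul_eq_mul]; ring

open Classical in
/-- The likelihood ratio for a subhypergraph planted on `S`, truncated to the event that the
likelihood ratio of every nonempty `T ⊆ S` is at most `exp (B |T|)`. -/
def truncatedRatio (m : ℕ) {N : ℕ} (p₀ p₁ : ℝ) (B : ℕ → ℝ) (S : Finset (Fin N))
    (A : Hypergraph m N) : ℝ :=
  if ∀ T ⊆ S, T.Nonempty → likelihoodRatio p₀ p₁ (edgesIn m T) A ≤ Real.exp (B T.card) then
    likelihoodRatio p₀ p₁ (edgesIn m S) A else 0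

section

variable {p₀ p₁ : ℝ} (h0 : 0 < p₀) (h01 : p₀ < p₁) (h1 : p₁ < 1) (B : ℕ → ℝ)
include h0 h01 h1

lemma truncatedRatio_nonneg (S : Finset (Fin N)) (A : Hypergraph m N) :
    0 ≤ truncatedRatio m p₀ p₁ B S A := by
  unfold truncatedRatio
  split_ifs
  exacts [(likelihoodRatio_pos h0 h01 h1 _ A).le, le_rfl]

lemma truncatedRatio_le (S : Finset (Fin N)) (A : Hypergraph m N) :
    truncatedRatio m p₀ p₁ B S A ≤ likelihoodRatio p₀ p₁ (edgesIn m S) A := by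
  unfold truncatedRatio
  split_ifs
  exacts [le_rfl, (likelihoodRatio_pos h0 h01 h1 _ A).le]

lemma sum_truncatedRatio_mul_le_pow (S S' : Finset (Fin N)) :
    ∑ A : Hypergraph m N, nullWeight p₀ A *
        (truncatedRatio m p₀ p₁ B S A * truncatedRatio m p₀ p₁ B S' A) ≤
      (1 + (p₁ - p₀) ^ 2 / (p₀ * (1 - p₀))) ^ (S ∩ S').card.choose m := by
  rw [← card_edgesIn, edgesIn_inter,
    ← sum_nullWeight_mul_likelihoodRatio_mul_likelihoodRatio h0 h01 h1]
  refine Finset.sum_le_sum fun A _ => mul_le_mul_of_nonneg_left ?_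
    (nullWeight_nonneg h0.le (h01.trans h1).le A)
  exact mul_le_mul (truncatedRatio_le h0 h01 h1 B S A) (truncatedRatio_le h0 h01 h1 B S' A)
    (truncatedRatio_nonneg h0 h01 h1 B S' A) (likelihoodRatio_pos h0 h01 h1 _ A).le

/-- The cutoff for `S`, applied to T = S ∩ S', bounds the overlap factor pointwise; the remaining
factor, the ratio on the union of the edge sets, has null mean 1. -/
lemma sum_truncatedRatio_mul_le_exp (S S' : Finset (Fin N)) (hne : (S ∩ S').Nonempty) :
    ∑ A : Hypergraph m N, nullWeight p₀ A *
        (truncatedRatio m p₀ p₁ B S A * truncatedRatio m p₀ p₁ B S' A) ≤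
      Real.exp (B (S ∩ S').card) := by
  have hle : ∀ A : Hypergraph m N,
      truncatedRatio m p₀ p₁ B S A * truncatedRatio m p₀ p₁ B S' A ≤
      Real.exp (B (S ∩ S').card) * likelihoodRatio p₀ p₁ (edgesIn m S ∪ edgesIn m S') A := by
    intro A
    by_cases hA : ∀ T ⊆ S, T.Nonempty →
        likelihoodRatio p₀ p₁ (edgesIn m T) A ≤ Real.exp (B T.card)
    · calc _ ≤ likelihoodRatio p₀ p₁ (edgesIn m S) A * likelihoodRatio p₀ p₁ (edgesIn m S') A :=
            mul_le_mul (truncatedRatio_le h0 h01 h1 B S A) (truncatedRatio_le h0 h01 h1 B S' A)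
              (truncatedRatio_nonneg h0 h01 h1 B S' A) (likelihoodRatio_pos h0 h01 h1 _ A).le
        _ ≤ _ := by
          rw [likelihoodRatio_mul, ← edgesIn_inter]
          exact mul_le_mul_of_nonneg_right (hA _ Finset.inter_subset_left hne)
            (likelihoodRatio_pos h0 h01 h1 _ A).le
    · have : truncatedRatio m p₀ p₁ B S A = 0 := by
        unfold truncatedRatio; rw [if_neg hA]
      rw [this, zero_mul]
      exact mul_nonneg (Real.exp_pos _).le (likelihoodRatio_pos h0 h01 h1 _ A).le
  calc _ ≤ ∑ A : Hypergraph m N, nullWeight p₀ A * (Real.exp (B (S ∩ S').card) *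
        likelihoodRatio p₀ p₁ (edgesIn m S ∪ edgesIn m S') A) :=
        Finset.sum_le_sum fun A _ => mul_le_mul_of_nonneg_left (hle A)
          (nullWeight_nonneg h0.le (h01.trans h1).le A)
    _ = Real.exp (B (S ∩ S').card) * ∑ A : Hypergraph m N, nullWeight p₀ A *
        likelihoodRatio p₀ p₁ (edgesIn m S ∪ edgesIn m S') A := by
        rw [Finset.mul_sum]
        exact Finset.sum_congr rfl fun A _ => by ring
    _ = _ := by rw [sum_nullWeight_mul_likelihoodRatio h0 h01 h1, mul_one]

/-- The lost mass is the planted probability that some T violates its cutoff. A union bound and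
Markov's inequality for the power `s |T|` of the ratio on T, with an exponent free to depend on |T|,
control it. -/
lemma one_sub_le_sum_truncatedRatio (s : ℕ → ℝ) (hs : ∀ k, 0 ≤ s k) (S : Finset (Fin N)) :
    1 - ∑ k ∈ Finset.range S.card, (S.card.choose (k + 1) : ℝ) *
        (Real.exp (-(s (k + 1) * B (k + 1))) *
          (p₁ * (p₁ / p₀) ^ s (k + 1) + (1 - p₁) * ((1 - p₁) / (1 - p₀)) ^ s (k + 1)) ^
            (k + 1).choose m) ≤
      ∑ A : Hypergraph m N, nullWeight p₀ A * truncatedRatio m p₀ p₁ B S A := by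
  set L : Finset (Fin N) → Hypergraph m N → ℝ :=
    fun T A => likelihoodRatio p₀ p₁ (edgesIn m T) A with hL
  have hLpos : ∀ T A, 0 < L T A := fun T A => likelihoodRatio_pos h0 h01 h1 _ A
  set G : Finset (Fin N) → Hypergraph m N → ℝ :=
    fun T A => Real.exp (-(s T.card * B T.card)) * L T A ^ s T.card with hG
  have hGnn : ∀ T A, 0 ≤ G T A := fun T A =>
    mul_nonneg (Real.exp_pos _).le (Real.rpow_nonneg (hLpos T A).le _)
  have hpt : ∀ A, L S A - ∑ T ∈ S.powerset.erase ∅, L S A * G T A ≤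
      truncatedRatio m p₀ p₁ B S A := by
    intro A
    by_cases hA : ∀ T ⊆ S, T.Nonempty →
        likelihoodRatio p₀ p₁ (edgesIn m T) A ≤ Real.exp (B T.card)
    · unfold truncatedRatio
      rw [if_pos hA]
      exact sub_le_self _ (Finset.sum_nonneg fun T _ => mul_nonneg (hLpos S A).le (hGnn T A))
    · unfold truncatedRatio
      rw [if_neg hA]
      push Not at hA
      obtain ⟨T, hTS, hT, hlt⟩ := hA
      have hmem : T ∈ S.powerset.erase ∅ :=
        Finset.mem_erase.2 ⟨hT.ne_empty, Finset.mem_powerset.2 hTS⟩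
      have h2 := Finset.single_le_sum (f := fun T => L S A * G T A)
        (fun T _ => mul_nonneg (hLpos S A).le (hGnn T A)) hmem
      have h3 : 1 ≤ G T A := by
        have : Real.exp (s T.card * B T.card) ≤ L T A ^ s T.card := by
          rw [mul_comm, Real.exp_mul]
          exact Real.rpow_le_rpow (Real.exp_pos _).le hlt.le (hs _)
        change 1 ≤ Real.exp (-(s T.card * B T.card)) * L T A ^ s T.card
        rw [Real.exp_neg, inv_mul_eq_div, le_div_iff₀ (Real.exp_pos _), one_mul]
        exact this
      have h4 : L S A * 1 ≤ L S A * G T A := mul_le_mul_of_nonneg_left h3 (hLpos S A).le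
      linarith
  have hG_exp : ∀ T ⊆ S, ∑ A : Hypergraph m N, nullWeight p₀ A * (L S A * G T A) =
      Real.exp (-(s T.card * B T.card)) *
        (p₁ * (p₁ / p₀) ^ s T.card + (1 - p₁) * ((1 - p₁) / (1 - p₀)) ^ s T.card) ^
          T.card.choose m := by
    intro T hT
    have h := sum_nullWeight_mul_likelihoodRatio_mul_prod h0 h01 h1 (edgesIn_mono (m := m) hT)
      (fun b => bernoulliRatio p₀ p₁ b ^ s T.card)
    rw [card_edgesIn] at h
    simp only [bernoulliRatio, cond_true, cond_false] at h
    rw [← h, Finset.mul_sum]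
    refine Finset.sum_congr rfl fun A _ => ?_
    have : L T A ^ s T.card = ∏ e ∈ edgesIn m T, bernoulliRatio p₀ p₁ (A e) ^ s T.card := by
      rw [hL]
      simp only [likelihoodRatio]
      rw [← Real.finsetProd_rpow]
      intro e _
      rcases A e <;> simp only [bernoulliRatio, cond_true, cond_false] <;>
        apply div_nonneg <;> linarith
    rw [hG]
    simp only
    rw [this]
    simp only [bernoulliRatio]
    ring
  have hsum : ∑ T ∈ S.powerset.erase ∅, Real.exp (-(s T.card * B T.card)) *
        (p₁ * (p₁ / p₀) ^ s T.card + (1 - p₁) * ((1 - p₁) / (1 - p₀)) ^ s T.card) ^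
          T.card.choose m = ∑ k ∈ Finset.range S.card, (S.card.choose (k + 1) : ℝ) *
        (Real.exp (-(s (k + 1) * B (k + 1))) *
          (p₁ * (p₁ / p₀) ^ s (k + 1) + (1 - p₁) * ((1 - p₁) / (1 - p₀)) ^ s (k + 1)) ^
            (k + 1).choose m) := by
    have h := Finset.sum_powerset_apply_card (fun k => Real.exp (-(s k * B k)) *
        (p₁ * (p₁ / p₀) ^ s k + (1 - p₁) * ((1 - p₁) / (1 - p₀)) ^ s k) ^ k.choose m) (x := S)
    rw [Finset.sum_range_succ', ← Finset.sum_erase_add _ _ (Finset.empty_mem_powerset S)] at h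
    simp only [Finset.card_empty, Nat.choose_zero_right, one_smul, nsmul_eq_mul] at h
    linarith
  rw [← hsum]
  calc _ = ∑ A : Hypergraph m N, nullWeight p₀ A *
        (L S A - ∑ T ∈ S.powerset.erase ∅, L S A * G T A) := by
        simp only [mul_sub, Finset.sum_sub_distrib]
        rw [sum_nullWeight_mul_likelihoodRatio h0 h01 h1]
        congr 1
        simp only [Finset.mul_sum]
        rw [Finset.sum_comm]
        refine Finset.sum_congr rfl fun T hT => ?_
        rw [← hG_exp T (Finset.mem_powerset.1 (Finset.mem_of_mem_erase hT))]
    _ ≤ _ := Finset.sum_le_sum fun A _ => mul_le_mul_of_nonneg_left (hpt A)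
          (nullWeight_nonneg h0.le (h01.trans h1).le A)

end

/-- No test beats risk `1 - c` if the contribution of overlaps of size `k` to the second moment of
the likelihood ratio truncated at `exp (B k)`, and the mass lost by truncating on vertex sets of
size `k`, are summably small. -/
lemma risk_ge_of_overlap_bounds {n : ℕ} {p₀ p₁ : unitInterval} (h0 : 0 < (p₀ : ℝ))
    (h01 : (p₀ : ℝ) < p₁) (h1 : (p₁ : ℝ) < 1) (hn : n ≤ N) (B s t : ℕ → ℝ)
    (hs : ∀ k, 0 ≤ s k) {τ δ c : ℝ} (hc : 0 < c) (hδ : 0 ≤ δ)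
    (ht : ∀ k, 0 ≤ t k) (htτ : ∑ k ∈ Finset.range n, t (k + 1) ≤ τ)
    (htail : ∀ k, 0 < k → k ≤ n → (n.choose k : ℝ) * (Real.exp (-(s k * B k)) *
      ((p₁ : ℝ) * ((p₁ : ℝ) / p₀) ^ s k + (1 - (p₁ : ℝ)) * ((1 - (p₁ : ℝ)) / (1 - p₀)) ^ s k) ^
        k.choose m) ≤ t k)
    (hsecond : ∀ k, 0 < k → k ≤ n →
      (1 + ((p₁ : ℝ) - p₀) ^ 2 / (p₀ * (1 - p₀))) ^ k.choose m ≤ 1 + δ ∨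
      (n.choose k : ℝ) * (((n : ℝ) / N) ^ k *
        min ((1 + ((p₁ : ℝ) - p₀) ^ 2 / (p₀ * (1 - p₀))) ^ k.choose m) (Real.exp (B k))) ≤ t k)
    (hm : 0 < m) (hτ : δ + 3 * τ ≤ c ^ 2) (T : Test m N) :
    1 - c ≤ risk m N n p₀ p₁ T := by
  classical
  set χ : ℝ := ((p₁ : ℝ) - p₀) ^ 2 / (p₀ * (1 - p₀)) with hχ
  have hχnn : 0 ≤ χ := div_nonneg (sq_nonneg _) (mul_nonneg h0.le (by linarith))
  refine risk_ge_of_truncated_second_moment h0 h01 h1 hn (truncatedRatio m (p₀ : ℝ) p₁ B)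
    (truncatedRatio_le h0 h01 h1 B) hc (τ := τ) (σ := δ + τ) ?_ ?_ (by linarith) T
  · intro S hS
    refine le_trans ?_ (one_sub_le_sum_truncatedRatio h0 h01 h1 B s hs S)
    rw [hS]
    have : ∑ k ∈ Finset.range n, (n.choose (k + 1) : ℝ) *
        (Real.exp (-(s (k + 1) * B (k + 1))) *
          ((p₁ : ℝ) * ((p₁ : ℝ) / p₀) ^ s (k + 1) +
            (1 - (p₁ : ℝ)) * ((1 - (p₁ : ℝ)) / (1 - p₀)) ^ s (k + 1)) ^
            (k + 1).choose m) ≤ ∑ k ∈ Finset.range n, t (k + 1) :=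
      Finset.sum_le_sum fun k hk => htail (k + 1) k.succ_pos (Finset.mem_range.1 hk)
    linarith
  · intro S hS
    set β : ℕ → ℝ := fun k => min ((1 + χ) ^ k.choose m) (Real.exp (B k)) with hβ
    have hβnn : ∀ k, 0 ≤ β k := fun k => le_min (by positivity) (Real.exp_pos _).le
    -- Harmless overlaps are charged to the main term 1 + δ, so only the others enter the union
    -- bound.
    set h : ℕ → ℝ := fun k => if k = 0 ∨ (1 + χ) ^ k.choose m ≤ 1 + δ then 0 else β k with hh
    have hhnn : ∀ k, 0 ≤ h k := by
      intro k; rw [hh]; dsimp only; split_ifs; exacts [le_rfl, hβnn k]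
    have hpair : ∀ S' : Finset (Fin N), ∑ A : Hypergraph m N, nullWeight (p₀ : ℝ) A *
        (truncatedRatio m p₀ p₁ B S A * truncatedRatio m p₀ p₁ B S' A) ≤
        (1 + δ) + h (S ∩ S').card := by
      intro S'
      have hu := sum_truncatedRatio_mul_le_pow (m := m) h0 h01 h1 B S S'
      rw [← hχ] at hu
      by_cases hk : (S ∩ S').card = 0 ∨ (1 + χ) ^ (S ∩ S').card.choose m ≤ 1 + δ
      · refine hu.trans ?_
        have : h (S ∩ S').card = 0 := by rw [hh]; dsimp only; rw [if_pos hk]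
        rw [this, add_zero]
        rcases hk with hk | hk
        · rw [hk, Nat.choose_eq_zero_of_lt hm, pow_zero]; linarith
        · exact hk
      · have e : h (S ∩ S').card = β (S ∩ S').card := by rw [hh]; dsimp only; rw [if_neg hk]
        rw [e]
        push Not at hk
        have := sum_truncatedRatio_mul_le_exp (m := m) h0 h01 h1 B S S'
          (Finset.card_ne_zero.1 hk.1)
        have h5 := le_min hu this
        simp only [hβ]
        linarith
    calc _ ≤ ∑ S' ∈ Finset.powersetCard n (Finset.univ : Finset (Fin N)),
          ((1 + δ) + h (S ∩ S').card) := Finset.sum_le_sum fun S' _ => hpair S'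
      _ ≤ (N.choose n : ℝ) * (1 + δ) + (N.choose n : ℝ) *
          ∑ k ∈ Finset.range (n + 1), (n.choose k : ℝ) * (((n : ℝ) / N) ^ k * h k) := by
          rw [Finset.sum_add_distrib, Finset.sum_const, Finset.card_powersetCard,
            Finset.card_univ, Fintype.card_fin, nsmul_eq_mul]
          exact add_le_add le_rfl (sum_apply_card_inter_le hn h hhnn hS)
      _ ≤ (N.choose n : ℝ) * (1 + δ) + (N.choose n : ℝ) * τ := by
          refine add_le_add le_rfl (mul_le_mul_of_nonneg_left ?_ (Nat.cast_nonneg _))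
          rw [Finset.sum_range_succ']
          have hz : h 0 = 0 := by rw [hh]; simp
          rw [hz, mul_zero, mul_zero, add_zero]
          refine le_trans (Finset.sum_le_sum fun k hk => ?_) htτ
          by_cases hk' : (1 + χ) ^ (k + 1).choose m ≤ 1 + δ
          · have : h (k + 1) = 0 := by rw [hh]; dsimp only; rw [if_pos (Or.inr hk')]
            rw [this, mul_zero, mul_zero]
            exact ht _
          · have : h (k + 1) = β (k + 1) := by
              rw [hh]; dsimp only; rw [if_neg]; push Not; exact ⟨k.succ_ne_zero, not_le.1 hk'⟩
            rw [this]
            exact (hsecond (k + 1) k.succ_pos (Finset.mem_range.1 hk)).resolve_left hk'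
      _ = _ := by ring

/-- No test beats risk `1 - c` if the untruncated second moment is nearly one. -/
lemma risk_ge_of_second_moment {n : ℕ} {p₀ p₁ : unitInterval} (h0 : 0 < (p₀ : ℝ))
    (h01 : (p₀ : ℝ) < p₁) (h1 : (p₁ : ℝ) < 1) (hn : n ≤ N) {c : ℝ} (hc : 0 < c)
    (hsecond : ∀ k ≤ n,
      (1 + ((p₁ : ℝ) - p₀) ^ 2 / (p₀ * (1 - p₀))) ^ k.choose m ≤ 1 + c ^ 2)
    (T : Test m N) : 1 - c ≤ risk m N n p₀ p₁ T := by
  refine risk_ge_of_truncated_second_moment h0 h01 h1 hn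
    (fun S => likelihoodRatio (p₀ : ℝ) p₁ (edgesIn m S)) (fun _ _ => le_rfl) hc (τ := 0)
    (σ := c ^ 2) ?_ ?_ (by linarith) T
  · intro S _
    rw [sum_nullWeight_mul_likelihoodRatio h0 h01 h1, sub_zero]
  · intro S hS
    calc _ ≤ ∑ _S' ∈ Finset.powersetCard n (Finset.univ : Finset (Fin N)), (1 + c ^ 2) := by
          refine Finset.sum_le_sum fun S' _ => ?_
          rw [sum_nullWeight_mul_likelihoodRatio_mul_likelihoodRatio h0 h01 h1, ← edgesIn_inter,
            card_edgesIn]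
          exact hsecond _ (hS ▸ Finset.card_le_card Finset.inter_subset_left)
      _ = _ := by
          rw [Finset.sum_const, Finset.card_powersetCard, Finset.card_univ, Fintype.card_fin,
            nsmul_eq_mul]

end Truncation

/-! ### Divergence, moment and binomial estimates -/

section Estimates

/-- The logarithm of the odds ratio of two Bernoulli parameters. -/
def logOddsRatio (p q : ℝ) : ℝ := Real.log (q * (1 - p) / (p * (1 - q)))

lemma log_ratio_pos {p q : ℝ} (h0 : 0 < p) (h01 : p < q) : 0 < Real.log (q / p) :=
  Real.log_pos ((one_lt_div h0).2 h01)

section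

variable {p q : ℝ} (h0 : 0 < p) (h01 : p < q) (h1 : q < 1)
include h0 h01 h1

lemma logOddsRatio_eq :
    logOddsRatio p q = Real.log (q / p) - Real.log ((1 - q) / (1 - p)) := by
  have hq : 0 < q := h0.trans h01
  have h2 : 0 < 1 - q := by linarith
  have h3 : 0 < 1 - p := by linarith
  unfold logOddsRatio
  rw [Real.log_div (by positivity) (by positivity), Real.log_div (by positivity) (by positivity),
    Real.log_div (by positivity) (by positivity), Real.log_mul (by positivity) (by positivity),
    Real.log_mul (by positivity) (by positivity)]
  ring

lemma log_ratio_le_logOddsRatio : Real.log (q / p) ≤ logOddsRatio p q := by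
  rw [logOddsRatio_eq h0 h01 h1]
  have : Real.log ((1 - q) / (1 - p)) ≤ 0 :=
    Real.log_nonpos (div_nonneg (by linarith) (by linarith))
      ((div_le_one (by linarith)).2 (by linarith))
  linarith

lemma logOddsRatio_pos : 0 < logOddsRatio p q :=
  (log_ratio_pos h0 h01).trans_le (log_ratio_le_logOddsRatio h0 h01 h1)

/-- A Poisson-type bound for the moments of the likelihood ratio of two Bernoulli laws. -/
lemma moment_bernoulliRatio_le {s : ℝ} (hs : 0 ≤ s) :
    q * (q / p) ^ s + (1 - q) * ((1 - q) / (1 - p)) ^ s ≤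
      Real.exp (s * bernoulliKL p q + q * ((s * logOddsRatio p q) ^ 2 *
        Real.exp (s * logOddsRatio p q))) := by
  have hq : 0 < q := h0.trans h01
  have hr : 0 < q / p := div_pos hq h0
  have hr' : 0 < (1 - q) / (1 - p) := div_pos (by linarith) (by linarith)
  have hθ := logOddsRatio_eq h0 h01 h1
  have hθpos := logOddsRatio_pos h0 h01 h1
  set θ := logOddsRatio p q with hθdef
  set Λ := Real.log ((1 - q) / (1 - p)) with hΛ
  have e1 : Real.log (q / p) = θ + Λ := by linarith
  have hKL : bernoulliKL p q = q * θ + Λ := by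
    unfold bernoulliKL
    rw [e1, ← hΛ]; ring
  rw [Real.rpow_def_of_pos hr, Real.rpow_def_of_pos hr', e1, ← hΛ, hKL]
  set l := s * θ with hl
  have hlnn : 0 ≤ l := mul_nonneg hs hθpos.le
  have e2 : q * Real.exp ((θ + Λ) * s) + (1 - q) * Real.exp (Λ * s) =
      Real.exp (Λ * s) * (1 + q * (Real.exp l - 1)) := by
    rw [show (θ + Λ) * s = Λ * s + l by rw [hl]; ring, Real.exp_add]; ring
  have e3 : s * (q * θ + Λ) + q * (l ^ 2 * Real.exp l) =
      Λ * s + q * (l + l ^ 2 * Real.exp l) := by rw [hl]; ring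
  rw [e2, e3, Real.exp_add]
  refine mul_le_mul_of_nonneg_left ?_ (Real.exp_pos _).le
  have hb : Real.exp l - 1 ≤ l * Real.exp l := by
    have h := Real.add_one_le_exp (-l)
    have h' := mul_le_mul_of_nonneg_right h (Real.exp_pos l).le
    rw [← Real.exp_add, neg_add_cancel, Real.exp_zero] at h'
    linarith
  -- The linear term, with Λs, makes up s times the divergence; only the quadratic remainder is an
  -- error.
  have hb2 : Real.exp l - 1 ≤ l + l ^ 2 * Real.exp l := by
    have := mul_le_mul_of_nonneg_left hb hlnn
    nlinarith
  calc 1 + q * (Real.exp l - 1) ≤ q * (l + l ^ 2 * Real.exp l) + 1 := by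
        have := mul_le_mul_of_nonneg_left hb2 hq.le
        linarith
    _ ≤ _ := Real.add_one_le_exp _

/-- Applying log x ≥ 1 - 1/x to the complementary term leaves p - q, which gives a Poisson
divergence as lower bound. -/
lemma mul_sub_log_le_bernoulliKL :
    q * (Real.log (q / p) - 1 + Real.exp (-Real.log (q / p))) ≤ bernoulliKL p q := by
  have hq : 0 < q := h0.trans h01
  have h2 : 0 < 1 - q := by linarith
  have h3 : 0 < 1 - p := by linarith
  rw [Real.exp_neg, Real.exp_log (div_pos hq h0), inv_div]
  unfold bernoulliKL
  have h := Real.one_sub_inv_le_log_of_pos (div_pos h2 h3)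
  rw [inv_div] at h
  have h' := mul_le_mul_of_nonneg_left h h2.le
  have e : (1 - q) * (1 - (1 - p) / (1 - q)) = p - q := by field_simp; ring
  have e' : q * (Real.log (q / p) - 1 + p / q) = q * Real.log (q / p) - q + p := by
    field_simp
  rw [e] at h'
  rw [e']
  linarith

end

/-- The function u - 1 + exp(-u) is quadratic near 0 and linear at infinity. A Taylor bound serves
below 1, the tangent of the exponential at 1 up to 4/3, and positivity of the exponential beyond. -/
lemma min_one_mul_le {u : ℝ} (hu : 0 ≤ u) : u * min 1 u ≤ 4 * (u - 1 + Real.exp (-u)) := by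
  rcases le_total u 1 with h | h
  · rw [min_eq_right h]
    have := Real.exp_bound (x := -u) (by rw [abs_neg, abs_of_nonneg hu]; exact h)
      (n := 3) (by norm_num)
    rw [abs_neg, abs_of_nonneg hu] at this
    have h2 := (abs_le.1 this).1
    norm_num [Finset.sum_range_succ, Nat.factorial] at h2
    nlinarith [mul_nonneg hu hu, mul_nonneg (mul_nonneg hu hu) (sub_nonneg.2 h)]
  · rw [min_eq_left h, mul_one]
    have h3 := Real.exp_pos (-u)
    rcases le_total (4 / 3) u with h4 | h4
    · linarith
    · have h5 : Real.exp (-u) ≥ Real.exp (-1) * (1 + (1 - u)) := by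
        have := Real.add_one_le_exp (1 - u)
        have h6 := mul_le_mul_of_nonneg_left this (Real.exp_pos (-1)).le
        rw [← Real.exp_add] at h6
        rw [show -1 + (1 - u) = -u by ring] at h6
        linarith
      have h7 : (1 : ℝ) / 3 ≤ Real.exp (-1) := by
        rw [Real.exp_neg, ← one_div]
        exact one_div_le_one_div_of_le (Real.exp_pos _) (by linarith [Real.exp_one_lt_d9])
      nlinarith

lemma choose_le_exp {n k : ℕ} (hk : 0 < k) (hn : 0 < n) :
    (n.choose k : ℝ) ≤ Real.exp (k * (1 + Real.log ((n : ℝ) / k))) := by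
  have hk' : (0 : ℝ) < k := by exact_mod_cast hk
  have hn' : (0 : ℝ) < n := by exact_mod_cast hn
  have h1 := Nat.choose_le_pow_div (α := ℝ) k n
  have h2 := Real.pow_div_factorial_le_exp (k : ℝ) hk'.le k
  rw [mul_add, mul_one, Real.exp_add, mul_comm (k : ℝ) (Real.log _), Real.exp_mul,
    Real.exp_log (div_pos hn' hk'), Real.rpow_natCast, div_pow]
  refine h1.trans ?_
  have hf : (0 : ℝ) < (k.factorial : ℝ) := by exact_mod_cast k.factorial_pos
  rw [div_le_iff₀ hf] at h2 ⊢
  have hkk : (0 : ℝ) < (k : ℝ) ^ k := by positivity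
  calc (n : ℝ) ^ k = (k : ℝ) ^ k * ((n : ℝ) ^ k / (k : ℝ) ^ k) := by field_simp
    _ ≤ (Real.exp k * k.factorial) * ((n : ℝ) ^ k / (k : ℝ) ^ k) := by gcongr
    _ = _ := by ring

/-- As m ≥ 2, a spare factor k/n survives; it later absorbs exponential losses at small k. -/
lemma choose_le_mul_div_mul_pow {m n k : ℕ} (hm : 2 ≤ m) (hkn : k ≤ n) (hn : 0 < n) :
    (k.choose m : ℝ) ≤ k * ((k : ℝ) / n) * (n : ℝ) ^ (m - 1) := by
  have hn' : (0 : ℝ) < n := by exact_mod_cast hn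
  obtain ⟨a, rfl⟩ : ∃ a, m = a + 2 := ⟨m - 2, by omega⟩
  have h : (k.choose (a + 2) : ℝ) ≤ (k : ℝ) ^ (a + 2) := by
    exact_mod_cast Nat.choose_le_pow k (a + 2)
  refine h.trans ?_
  rw [show a + 2 - 1 = a + 1 by omega]
  have h2 : (k : ℝ) ^ a ≤ (n : ℝ) ^ a := by gcongr
  calc (k : ℝ) ^ (a + 2) = (k : ℝ) ^ 2 * (k : ℝ) ^ a := by ring
    _ ≤ (k : ℝ) ^ 2 * (n : ℝ) ^ a := by gcongr
    _ = _ := by field_simp; ring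

lemma choose_mul_factorial_eq_prod {m k : ℕ} (hm : 0 < m) (hk : m ≤ k) :
    (k.choose m : ℝ) * m.factorial = k * ∏ j ∈ Finset.Icc 1 (m - 1), ((k : ℝ) - (j : ℝ)) := by
  obtain ⟨a, rfl⟩ : ∃ a, m = a + 1 := ⟨m - 1, by omega⟩
  have h : (k.choose (a + 1) : ℝ) * (a + 1).factorial = (k.descFactorial (a + 1) : ℝ) := by
    rw [Nat.descFactorial_eq_factorial_mul_choose, Nat.cast_mul, mul_comm]
  rw [h, Nat.descFactorial_eq_prod_range, Finset.prod_range_succ', Nat.cast_mul, Nat.cast_prod,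
    mul_comm, Nat.sub_zero, Nat.add_sub_cancel]
  congr 1
  have hI : Finset.Icc 1 a = Finset.Ico 1 (a + 1) := by
    ext; simp only [Finset.mem_Icc, Finset.mem_Ico]; omega
  rw [hI, Finset.prod_Ico_eq_prod_range, Nat.add_sub_cancel]
  refine Finset.prod_congr rfl fun i hi => ?_
  have := Finset.mem_range.1 hi
  rw [Nat.cast_sub (by omega), add_comm 1 i]

/-- The scan condition at `n` passes to every subset size k ≤ n, because (k choose m)/k is
nondecreasing in k. -/
lemma choose_mul_le_of_prod_mul_le {m n k : ℕ} (hm : 0 < m) (hk : k ≤ n) {D b : ℝ}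
    (hD : 0 ≤ D) (hb : 0 ≤ b)
    (h : (∏ j ∈ Finset.Icc 1 (m - 1), ((n : ℝ) - (j : ℝ))) * D ≤ m.factorial * b) :
    (k.choose m : ℝ) * D ≤ k * b := by
  rcases lt_or_ge k m with hkm | hkm
  · rw [Nat.choose_eq_zero_of_lt hkm]
    simp only [Nat.cast_zero, zero_mul]
    positivity
  · have hf : (0 : ℝ) < (m.factorial : ℝ) := by exact_mod_cast m.factorial_pos
    refine le_of_mul_le_mul_left ?_ hf
    have hkn : (k : ℝ) ≤ n := by exact_mod_cast hk
    have hprod : ∏ j ∈ Finset.Icc 1 (m - 1), ((k : ℝ) - (j : ℝ)) ≤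
        ∏ j ∈ Finset.Icc 1 (m - 1), ((n : ℝ) - (j : ℝ)) := by
      refine Finset.prod_le_prod (fun j hj => ?_) (fun j _ => by linarith)
      have : j ≤ k := by have := (Finset.mem_Icc.1 hj).2; omega
      have : (j : ℝ) ≤ k := by exact_mod_cast this
      linarith
    calc (m.factorial : ℝ) * ((k.choose m : ℝ) * D)
        = ((k.choose m : ℝ) * m.factorial) * D := by ring
      _ = k * ((∏ j ∈ Finset.Icc 1 (m - 1), ((k : ℝ) - (j : ℝ))) * D) := by
          rw [choose_mul_factorial_eq_prod hm hkm]; ring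
      _ ≤ k * ((∏ j ∈ Finset.Icc 1 (m - 1), ((n : ℝ) - (j : ℝ))) * D) := by gcongr
      _ ≤ k * (m.factorial * b) := by gcongr
      _ = _ := by ring

/-- The chi-square divergence exceeds the Poisson scale q θ min(1, θ) by at most exp θ, up to 1/(1 -
p); the loss is affordable when θ is a small multiple of log(N/n). -/
lemma chi_sq_le {p q : ℝ} (h0 : 0 < p) (h01 : p < q) (h1 : q < 1) :
    (q - p) ^ 2 / (p * (1 - p)) ≤
      q * (logOddsRatio p q * min 1 (logOddsRatio p q)) * Real.exp (logOddsRatio p q) /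
        (1 - p) := by
  have hq : 0 < q := h0.trans h01
  have h2 : 0 < 1 - q := by linarith
  have h3 : 0 < 1 - p := by linarith
  have hu := log_ratio_le_logOddsRatio h0 h01 h1
  have hθ := logOddsRatio_pos h0 h01 h1
  set θ := logOddsRatio p q with hθdef
  have hexp : q / p ≤ Real.exp θ := by
    rw [← Real.log_le_iff_le_exp (div_pos hq h0)]; exact hu
  have ha : 1 - p / q ≤ min 1 θ := by
    refine le_min (by linarith [div_pos h0 hq]) ?_
    have := Real.one_sub_inv_le_log_of_pos (div_pos hq h0)
    rw [inv_div] at this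
    linarith
  have ha0 : 0 ≤ 1 - p / q := sub_nonneg.2 ((div_le_one hq).2 h01.le)
  have hb : (1 - p / q) ^ 2 ≤ θ * min 1 θ := by
    rw [sq]
    exact mul_le_mul (ha.trans (min_le_right _ _)) ha ha0 hθ.le
  rw [← div_div]
  gcongr
  calc (q - p) ^ 2 / p = q * (1 - p / q) ^ 2 * (q / p) := by field_simp
    _ ≤ q * (θ * min 1 θ) * Real.exp θ := by gcongr

end Estimates

/-! ### The regime of large log(N/n) -/

section LargeRatio

/-- If `k` vertices out of `n` are chosen, the union bound over the choices beats the probability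
that the likelihood ratio on `k` vertices exceeds `exp (k (1 - ε / 2) L)`. -/
lemma tail_bound {m n k : ℕ} (hm : 2 ≤ m) (hk : 0 < k) (hkn : k ≤ n) {p q L ε K κ M b : ℝ}
    (h0 : 0 < p) (h01 : p < q) (h1 : q < 1) (hL : 0 < L) (hb : 0 < b) (hb2 : b ≤ 1 / 2)
    (hκ : 0 < κ) (hM : 0 ≤ M) (hD0 : 0 ≤ bernoulliKL p q) (hε1 : ε ≤ 1)
    (hscan : (∏ j ∈ Finset.Icc 1 (m - 1), ((n : ℝ) - (j : ℝ))) * bernoulliKL p q ≤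
      m.factorial * ((1 - ε) * L))
    (hK : (n : ℝ) ^ (m - 1) * (q * (logOddsRatio p q * min 1 (logOddsRatio p q))) ≤ K * L)
    (hθκ : logOddsRatio p q ≤ κ * L) (hκ1 : 1 ≤ κ * L) (hKb : 16 * K * b ≤ ε)
    (hκM : κ * (M + 1) ≤ b * ε / 4) :
    (n.choose k : ℝ) * (Real.exp (-((b * min 1 (logOddsRatio p q) *
        (1 + Real.log ((n : ℝ) / k)) / logOddsRatio p q) * (k * ((1 - ε / 2) * L)))) *
      (q * (q / p) ^ (b * min 1 (logOddsRatio p q) *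
        (1 + Real.log ((n : ℝ) / k)) / logOddsRatio p q) +
        (1 - q) * ((1 - q) / (1 - p)) ^ (b * min 1 (logOddsRatio p q) *
        (1 + Real.log ((n : ℝ) / k)) / logOddsRatio p q)) ^ k.choose m) ≤
      Real.exp (-(M * k)) := by
  have hn : 0 < n := by omega
  have hk' : (0 : ℝ) < k := by exact_mod_cast hk
  have hn' : (0 : ℝ) < n := by exact_mod_cast hn
  have hkn' : (k : ℝ) ≤ n := by exact_mod_cast hkn
  have hq : 0 < q := h0.trans h01
  have hθ := logOddsRatio_pos h0 h01 h1
  have hmom := fun s (hs : 0 ≤ s) => moment_bernoulliRatio_le h0 h01 h1 (s := s) hs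
  set θ := logOddsRatio p q with hθdef
  set D := bernoulliKL p q with hDdef
  set ρ := min 1 θ with hρdef
  have hρ : 0 < ρ := lt_min one_pos hθ
  set l := 1 + Real.log ((n : ℝ) / k) with hl
  have hl1 : 1 ≤ l := by
    have := Real.log_nonneg ((one_le_div hk').2 hkn')
    linarith
  -- This exponent makes sθ = bρl: small enough for the Poisson error, yet sL dominates the entropy
  -- l per vertex because θ ≤ κL.
  set s := b * ρ * l / θ with hs
  have hspos : 0 < s := by rw [hs]; positivity
  have hsθ : s * θ = b * ρ * l := by rw [hs]; field_simp
  have hC := choose_le_mul_div_mul_pow hm hkn hn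
  have hCD := choose_mul_le_of_prod_mul_le (by omega) hkn hD0 (by
    have : 0 ≤ 1 - ε := by linarith
    positivity) hscan
  set C : ℝ := (k.choose m : ℝ) with hCdef
  have hCnn : 0 ≤ C := Nat.cast_nonneg _
  have hx : (k : ℝ) / n = Real.exp (1 - l) := by
    rw [hl, show 1 - (1 + Real.log ((n : ℝ) / k)) = -Real.log ((n : ℝ) / k) by ring,
      Real.exp_neg, Real.exp_log (by positivity), inv_div]
  have hxl : (k : ℝ) / n * l * Real.exp (s * θ) ≤ 2 := by
    -- Since k/n = exp(1 - l), the spare factor k/n beats exp(sθ) ≤ exp(l/2).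
    have h5 : s * θ ≤ l / 2 := by
      rw [hsθ]
      have : b * ρ ≤ 1 / 2 * 1 := mul_le_mul hb2 (min_le_left _ _) hρ.le (by norm_num)
      have := mul_le_mul_of_nonneg_right this (by linarith : 0 ≤ l)
      linarith
    have h6 : Real.exp (s * θ) ≤ Real.exp (l / 2) := Real.exp_le_exp.2 h5
    calc (k : ℝ) / n * l * Real.exp (s * θ) ≤ (k : ℝ) / n * l * Real.exp (l / 2) := by gcongr
      _ = l * Real.exp (-(l / 2 - 1)) := by
          rw [hx, mul_right_comm, ← Real.exp_add, mul_comm]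
          congr 2; ring
      _ ≤ 2 := by
          rw [Real.exp_neg, ← div_eq_mul_inv, div_le_iff₀ (Real.exp_pos _)]
          linarith [Real.add_one_le_exp (l / 2 - 1)]
  have hKpos : 0 ≤ K := by
    have h7 : 0 ≤ K * L := le_trans (by positivity) hK
    exact nonneg_of_mul_nonneg_left h7 hL
  have hpois : C * (q * ((s * θ) ^ 2 * Real.exp (s * θ))) ≤ k * (s * L) * (ε / 8) := by
    have h8 : (n : ℝ) ^ (m - 1) * q * ρ ≤ K * L / θ := by
      rw [le_div_iff₀ hθ]; linarith
    calc C * (q * ((s * θ) ^ 2 * Real.exp (s * θ)))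
        ≤ (k * ((k : ℝ) / n) * (n : ℝ) ^ (m - 1)) * (q * ((s * θ) ^ 2 * Real.exp (s * θ))) := by
          gcongr
      _ = ((n : ℝ) ^ (m - 1) * q * ρ) * (k * b * (s * θ) *
          ((k : ℝ) / n * l * Real.exp (s * θ))) := by
          rw [sq]; nth_rewrite 1 [hsθ]; ring
      _ ≤ (K * L / θ) * (k * b * (s * θ) * 2) := by gcongr
      _ = k * (s * L) * (2 * K * b) := by field_simp
      _ ≤ k * (s * L) * (ε / 8) := by gcongr; linarith
  have hsL : l * (M + 1) ≤ s * L * (ε / 4) := by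
    have h9 : θ ≤ κ * (ρ * L) := by
      rcases le_total θ 1 with h | h
      · rw [hρdef, min_eq_right h]; nlinarith
      · rw [hρdef, min_eq_left h]; linarith
    have h10 : b * l ≤ κ * (s * L) := by
      rw [hs, show κ * (b * ρ * l / θ * L) = b * l * (κ * (ρ * L)) / θ by ring,
        le_div_iff₀ hθ]
      gcongr
    have hε0 : 0 ≤ ε := le_trans (by positivity) hKb
    refine le_of_mul_le_mul_left ?_ hκ
    calc κ * (l * (M + 1)) = l * (κ * (M + 1)) := by ring
      _ ≤ l * (b * ε / 4) := by gcongr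
      _ = (b * l) * (ε / 4) := by ring
      _ ≤ κ * (s * L) * (ε / 4) := by gcongr
      _ = _ := by ring
  calc _ ≤ Real.exp (k * l) * (Real.exp (-(s * (k * ((1 - ε / 2) * L)))) *
        Real.exp (s * D + q * ((s * θ) ^ 2 * Real.exp (s * θ))) ^ k.choose m) := by
        have hbase : 0 ≤ q * (q / p) ^ s + (1 - q) * ((1 - q) / (1 - p)) ^ s := by
          have h2 : 0 < 1 - q := by linarith
          have h3 : 0 < 1 - p := by linarith
          positivity
        gcongr
        · exact choose_le_exp hk hn
        · exact hmom s hspos.le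
    _ = Real.exp (k * l - s * (k * ((1 - ε / 2) * L)) +
        (s * (C * D) + C * (q * ((s * θ) ^ 2 * Real.exp (s * θ))))) := by
        rw [← Real.exp_nat_mul, ← Real.exp_add, ← Real.exp_add]
        congr 1; ring
    _ ≤ _ := by
        -- The cutoff exceeds the mean by ksLε/2. The Poisson error takes ksLε/8, and ksLε/4 covers
        -- kl(M + 1), leaving at most -Mkl ≤ -Mk.
        refine Real.exp_le_exp.2 ?_
        have h11 := mul_le_mul_of_nonneg_left hCD hspos.le
        have h12 := mul_le_mul_of_nonneg_left hsL hk'.le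
        have h13 := mul_le_mul_of_nonneg_left hl1 (mul_nonneg hM hk'.le)
        have hε0 : 0 ≤ ε := le_trans (by positivity) hKb
        have h14 : 0 ≤ k * (s * L) * ε := by positivity
        linarith

/-- Overlaps of size `k` contribute little to the truncated second moment unless
`k ≤ exp (M + 2) n² / N`. -/
lemma overlap_bound {m n N k : ℕ} (hm : 2 ≤ m) (hk : 0 < k) (hkn : k ≤ n) (hnN : n < N)
    {χ L ε κ M K' θ : ℝ} (hLdef : L = Real.log ((N : ℝ) / n)) (hχ0 : 0 ≤ χ)
    (hχ : (n : ℝ) ^ (m - 1) * χ ≤ K' * L * Real.exp θ)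
    (hθκ : θ ≤ κ * L) (hκε : κ ≤ ε / 8) (hK'0 : 0 ≤ K')
    (hK' : K' * L * Real.exp (-(ε / 8 * L)) ≤ 1) (hεL : M + 1 ≤ ε / 4 * L)
    (hkA : Real.exp (M + 2) * ((n : ℝ) ^ 2 / N) < k) :
    (n.choose k : ℝ) * (((n : ℝ) / N) ^ k *
        min ((1 + χ) ^ k.choose m) (Real.exp (k * ((1 - ε / 2) * L)))) ≤
      Real.exp (-(M * k)) := by
  have hn : 0 < n := by omega
  have hk' : (0 : ℝ) < k := by exact_mod_cast hk
  have hn' : (0 : ℝ) < n := by exact_mod_cast hn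
  have hN' : (0 : ℝ) < N := by exact_mod_cast hn.trans hnN
  have hL : 0 < L := by
    rw [hLdef]; exact Real.log_pos ((one_lt_div hn').2 (by exact_mod_cast hnN))
  have hpow : ((n : ℝ) / N) ^ k = Real.exp (-(k * L)) := by
    rw [← mul_neg, Real.exp_nat_mul, hLdef, Real.exp_neg, Real.exp_log (by positivity), inv_div]
  have hch := choose_le_exp hk hn
  set l := Real.log ((n : ℝ) / k) with hl
  have hgoal : ∀ y : ℝ, min ((1 + χ) ^ k.choose m) (Real.exp (k * ((1 - ε / 2) * L))) ≤
      Real.exp y → k * (1 + l) - k * L + y ≤ -(M * k) → (n.choose k : ℝ) * (((n : ℝ) / N) ^ k *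
        min ((1 + χ) ^ k.choose m) (Real.exp (k * ((1 - ε / 2) * L)))) ≤
      Real.exp (-(M * k)) := by
    intro y hy hle
    calc _ ≤ Real.exp (k * (1 + l)) * (Real.exp (-(k * L)) * Real.exp y) := by
          rw [hpow]
          have : 0 ≤ min ((1 + χ) ^ k.choose m) (Real.exp (k * ((1 - ε / 2) * L))) :=
            le_min (by positivity) (Real.exp_pos _).le
          gcongr
      _ = Real.exp (k * (1 + l) - k * L + y) := by
          rw [← Real.exp_add, ← Real.exp_add]; congr 1; ring
      _ ≤ _ := Real.exp_le_exp.2 hle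
  -- For k close to n on this logarithmic scale the cutoff is used. Otherwise k/n ≤ exp(-εL/4)
  -- outweighs exp θ, so (1 + χ)^(k choose m) ≤ exp k.
  rcases le_total l (ε / 4 * L) with hcase | hcase
  · refine hgoal _ (min_le_right _ _) ?_
    have := mul_le_mul_of_nonneg_left
      (show 1 + l - L + (1 - ε / 2) * L ≤ -M by linarith) hk'.le
    linarith
  · refine hgoal k ((min_le_left _ _).trans ?_) ?_
    · calc (1 + χ) ^ k.choose m ≤ Real.exp χ ^ k.choose m := by
            gcongr; linarith [Real.add_one_le_exp χ]
        _ = Real.exp ((k.choose m : ℝ) * χ) := (Real.exp_nat_mul _ _).symm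
        _ ≤ Real.exp k := by
            refine Real.exp_le_exp.2 ?_
            have hx : (k : ℝ) / n = Real.exp (-l) := by
              rw [hl, Real.exp_neg, Real.exp_log (by positivity), inv_div]
            calc (k.choose m : ℝ) * χ ≤ (k * ((k : ℝ) / n) * (n : ℝ) ^ (m - 1)) * χ := by
                  gcongr; exact choose_le_mul_div_mul_pow hm hkn hn
              _ = k * Real.exp (-l) * ((n : ℝ) ^ (m - 1) * χ) := by rw [hx]; ring
              _ ≤ k * Real.exp (-(ε / 4 * L)) * (K' * L * Real.exp (ε / 8 * L)) := by
                  refine mul_le_mul (by gcongr) (hχ.trans ?_) (by positivity) (by positivity)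
                  gcongr
                  exact hθκ.trans (mul_le_mul_of_nonneg_right hκε hL.le)
              _ = k * (K' * L * Real.exp (-(ε / 8 * L))) := by
                  have : Real.exp (-(ε / 8 * L)) =
                      Real.exp (-(ε / 4 * L)) * Real.exp (ε / 8 * L) := by
                    rw [← Real.exp_add]; congr 1; ring
                  rw [this]; ring
              _ ≤ k * 1 := by gcongr
              _ = k := mul_one _
    · have h2 : l - L < -(M + 2) := by
        have e : l - L = Real.log ((n : ℝ) ^ 2 / N / k) := by
          rw [hl, hLdef, ← Real.log_div (by positivity) (by positivity)]
          congr 1; field_simp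
        rw [e, Real.log_lt_iff_lt_exp (by positivity), Real.exp_neg, div_lt_iff₀ hk',
          inv_mul_eq_div, lt_div_iff₀ (Real.exp_pos _)]
        linarith
      have := mul_le_mul_of_nonneg_left h2.le hk'.le
      linarith

lemma sum_exp_neg_le {M : ℝ} (hM : 1 ≤ M) (n : ℕ) :
    ∑ k ∈ Finset.range n, Real.exp (-(M * ((k + 1 : ℕ) : ℝ))) ≤ 2 * Real.exp (-M) := by
  have hr : Real.exp (-M) ≤ 1 / 2 := by
    rw [Real.exp_neg, ← one_div]
    exact one_div_le_one_div_of_le (by norm_num) (by linarith [Real.add_one_le_exp M])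
  have hr0 := Real.exp_pos (-M)
  have e : ∀ k : ℕ, Real.exp (-(M * ((k + 1 : ℕ) : ℝ))) = Real.exp (-M) * Real.exp (-M) ^ k := by
    intro k
    rw [← Real.exp_nat_mul, ← Real.exp_add]
    congr 1; push_cast; ring
  rw [Finset.sum_congr rfl fun k _ => e k, ← Finset.mul_sum, mul_comm]
  refine mul_le_mul_of_nonneg_right ?_ hr0.le
  calc ∑ k ∈ Finset.range n, Real.exp (-M) ^ k ≤ ∑' k : ℕ, Real.exp (-M) ^ k :=
        (summable_geometric_of_lt_one hr0.le (by linarith)).sum_le_tsum _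
          (fun k _ => by positivity)
    _ = (1 - Real.exp (-M))⁻¹ := tsum_geometric_of_lt_one hr0.le (by linarith)
    _ ≤ 2 := by
        rw [inv_le_comm₀ (by linarith) (by norm_num)]; linarith

/-- The risk bound in the regime where `L = log (N / n)` is large. -/
lemma risk_ge_of_large_ratio {m N n : ℕ} (hm : 2 ≤ m) (hn : 0 < n) (hnN : n < N)
    {p₀ p₁ : unitInterval} (h0 : 0 < (p₀ : ℝ)) (h01 : (p₀ : ℝ) < p₁) (h1 : (p₁ : ℝ) < 1)
    {L ε K K' κ M b δ c : ℝ} (hLdef : L = Real.log ((N : ℝ) / n))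
    (hb : 0 < b) (hb2 : b ≤ 1 / 2) (hκ : 0 < κ) (hM : 1 ≤ M) (hε1 : ε ≤ 1)
    (hscan : (∏ j ∈ Finset.Icc 1 (m - 1), ((n : ℝ) - (j : ℝ))) * bernoulliKL p₀ p₁ ≤
      m.factorial * ((1 - ε) * L))
    (hK : (n : ℝ) ^ (m - 1) * ((p₁ : ℝ) * (logOddsRatio p₀ p₁ * min 1 (logOddsRatio p₀ p₁))) ≤
      K * L)
    (hχ : (n : ℝ) ^ (m - 1) * (((p₁ : ℝ) - p₀) ^ 2 / (p₀ * (1 - p₀))) ≤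
      K' * L * Real.exp (logOddsRatio p₀ p₁))
    (hD0 : 0 ≤ bernoulliKL p₀ p₁)
    (hθκ : logOddsRatio p₀ p₁ ≤ κ * L) (hκ1 : 1 ≤ κ * L) (hKb : 16 * K * b ≤ ε)
    (hκM : κ * (M + 1) ≤ b * ε / 4) (hκε : κ ≤ ε / 8) (hK'0 : 0 ≤ K')
    (hK' : K' * L * Real.exp (-(ε / 8 * L)) ≤ 1) (hεL : M + 1 ≤ ε / 4 * L)
    (hc : 0 < c) (hδ : 0 ≤ δ) (hδM : δ + 6 * Real.exp (-M) ≤ c ^ 2)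
    (hsmall : ∀ k ≤ n, (k : ℝ) ≤ Real.exp (M + 2) * ((n : ℝ) ^ 2 / N) →
      (1 + ((p₁ : ℝ) - p₀) ^ 2 / (p₀ * (1 - p₀))) ^ k.choose m ≤ 1 + δ)
    (T : Test m N) : 1 - c ≤ risk m N n p₀ p₁ T := by
  have hn' : (0 : ℝ) < n := by exact_mod_cast hn
  have hL : 0 < L := by
    rw [hLdef]; exact Real.log_pos ((one_lt_div hn').2 (by exact_mod_cast hnN))
  have hθ := logOddsRatio_pos h0 h01 h1
  have hl : ∀ k : ℕ, k ≤ n → 0 ≤ 1 + Real.log ((n : ℝ) / k) := by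
    intro k hk
    rcases Nat.eq_zero_or_pos k with h | h
    · subst h; simp
    · have : 0 ≤ Real.log ((n : ℝ) / k) :=
        Real.log_nonneg ((one_le_div (by exact_mod_cast h)).2 (by exact_mod_cast hk))
      linarith
  refine risk_ge_of_overlap_bounds h0 h01 h1 hnN.le (fun k => k * ((1 - ε / 2) * L))
    -- The default 0 keeps the exponent nonnegative for k > n, where 1 + log(n/k) may be negative.
    (fun k => if k ≤ n then b * min 1 (logOddsRatio p₀ p₁) *
        (1 + Real.log ((n : ℝ) / k)) / logOddsRatio p₀ p₁ else 0)
    (fun k => Real.exp (-(M * k))) ?_ hc hδ (fun k => (Real.exp_pos _).le)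
    (sum_exp_neg_le hM n) ?_ ?_ (by omega) (by linarith) T
  · intro k
    split_ifs with hk
    · exact div_nonneg (mul_nonneg (mul_nonneg hb.le (le_min zero_le_one hθ.le)) (hl k hk)) hθ.le
    · exact le_rfl
  · intro k hk hkn
    simp only [if_pos hkn]
    exact tail_bound hm hk hkn h0 h01 h1 hL hb hb2 hκ (by linarith) hD0 hε1 hscan hK hθκ hκ1
      hKb hκM
  · intro k hk hkn
    rcases le_or_gt (k : ℝ) (Real.exp (M + 2) * ((n : ℝ) ^ 2 / N)) with h | h
    · exact Or.inl (hsmall k hkn h)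
    · exact Or.inr (overlap_bound hm hk hkn hnN hLdef
        (div_nonneg (sq_nonneg _) (mul_nonneg h0.le (by linarith))) hχ hθκ hκε hK'0 hK' hεL h)

end LargeRatio

/-! ### Consequences of the rate conditions and choice of constants -/

section Asymptotics

section

variable {p q : ℝ} (h0 : 0 < p) (h01 : p < q) (h1 : q < 1)
include h0 h01 h1

lemma mul_log_ratio_mul_min_le_bernoulliKL :
    q * (Real.log (q / p) * min 1 (Real.log (q / p))) ≤ 4 * bernoulliKL p q := by
  have h2 := mul_le_mul_of_nonneg_left (min_one_mul_le (log_ratio_pos h0 h01).le)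
    (h0.trans h01).le
  have h3 := mul_sub_log_le_bernoulliKL h0 h01 h1
  linarith

lemma bernoulliKL_nonneg : 0 ≤ bernoulliKL p q := by
  have h2 := mul_log_ratio_mul_min_le_bernoulliKL h0 h01 h1
  have h3 := log_ratio_pos h0 h01
  have h4 : 0 ≤ q * (Real.log (q / p) * min 1 (Real.log (q / p))) :=
    mul_nonneg (h0.trans h01).le (mul_nonneg h3.le (le_min zero_le_one h3.le))
  linarith

/-- The complementary part of the log odds is at most (q - p)/(1 - q), and q - p ≤ log(q/p). -/
lemma logOddsRatio_le_mul_log_ratio {a : ℝ} (ha : a < 1) (hqa : q ≤ a) :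
    logOddsRatio p q ≤ (1 + 1 / (1 - a)) * Real.log (q / p) := by
  have hq : 0 < q := h0.trans h01
  have h2 : 0 < 1 - q := by linarith
  have h3 : 0 < 1 - p := by linarith
  have h4 : 0 < 1 - a := by linarith
  have hu : 1 - p / q ≤ Real.log (q / p) := by
    have := Real.one_sub_inv_le_log_of_pos (div_pos hq h0)
    rwa [inv_div] at this
  have hv : 1 - (1 - p) / (1 - q) ≤ Real.log ((1 - q) / (1 - p)) := by
    have := Real.one_sub_inv_le_log_of_pos (div_pos h2 h3)
    rwa [inv_div] at this
  have e : (1 - p) / (1 - q) - 1 = (q - p) / (1 - q) := by field_simp; ring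
  have h5 : (q - p) / (1 - q) ≤ Real.log (q / p) / (1 - a) := by
    have h6 : q - p ≤ Real.log (q / p) := by
      have e2 : q - p = q * (1 - p / q) := by field_simp
      have h7 : 0 ≤ 1 - p / q := sub_nonneg.2 ((div_le_one hq).2 h01.le)
      rw [e2]
      nlinarith
    exact div_le_div₀ (log_ratio_pos h0 h01).le h6 h4 (by linarith)
  rw [logOddsRatio_eq h0 h01 h1, add_mul, one_mul, one_div_mul_eq_div]
  linarith

lemma mul_logOddsRatio_mul_min_le {a : ℝ} (ha : a < 1) (hqa : q ≤ a) :
    q * (logOddsRatio p q * min 1 (logOddsRatio p q)) ≤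
      4 * (1 + 1 / (1 - a)) ^ 2 * bernoulliKL p q := by
  have hq : 0 < q := h0.trans h01
  have h4 : 0 < 1 - a := by linarith
  have hu := log_ratio_pos h0 h01
  have hθ := logOddsRatio_pos h0 h01 h1
  have hle := logOddsRatio_le_mul_log_ratio h0 h01 h1 ha hqa
  have hD := mul_log_ratio_mul_min_le_bernoulliKL h0 h01 h1
  set u := Real.log (q / p)
  set θ := logOddsRatio p q
  set C := 1 + 1 / (1 - a) with hC
  have hC1 : 1 ≤ C := by
    have : 0 < 1 / (1 - a) := by positivity
    linarith
  have hmin : min 1 θ ≤ C * min 1 u := by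
    rw [mul_min_of_nonneg _ _ (by linarith : 0 ≤ C), mul_one]
    exact min_le_min hC1 hle
  calc q * (θ * min 1 θ) ≤ q * ((C * u) * (C * min 1 u)) := by
        refine mul_le_mul_of_nonneg_left ?_ hq.le
        exact mul_le_mul hle hmin (le_min zero_le_one hθ.le) (by positivity)
    _ = C ^ 2 * (q * (u * min 1 u)) := by ring
    _ ≤ C ^ 2 * (4 * bernoulliKL p q) := by gcongr
    _ = _ := by ring

/-- For θ ≥ 1 the hypothesis gives wq ≤ KL, and the odds ratio is at most wq/(1 - a) times 1/(wp).
With w = n^(m-1), the last factor is what the second rate condition controls. -/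
lemma logOddsRatio_le_log_add_log {a w K L : ℝ} (ha : a < 1) (hqa : q ≤ a) (hw : 0 < w)
    (hL : 0 < L) (hK0 : 0 < K) (hθ1 : 1 ≤ logOddsRatio p q)
    (hK : w * (q * (logOddsRatio p q * min 1 (logOddsRatio p q))) ≤ K * L) :
    logOddsRatio p q ≤ Real.log (K / (1 - a) * L) + Real.log (max 1 (1 / (w * p))) := by
  have hq : 0 < q := h0.trans h01
  have h2 : 0 < 1 - q := by linarith
  have h3 : 0 < 1 - p := by linarith
  have h4 : 0 < 1 - a := by linarith
  rw [min_eq_left hθ1, mul_one] at hK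
  have hwq : w * q ≤ K * L := by
    refine le_trans ?_ hK
    rw [← mul_assoc]
    exact le_mul_of_one_le_right (by positivity) hθ1
  have hmax : 0 < max 1 (1 / (w * p)) := lt_max_of_lt_left one_pos
  rw [← Real.log_mul (by positivity) hmax.ne']
  unfold logOddsRatio
  refine Real.log_le_log (by positivity) ?_
  calc q * (1 - p) / (p * (1 - q)) ≤ q * 1 / (p * (1 - a)) := by
        gcongr; linarith
    _ = (w * q) / (1 - a) * (1 / (w * p)) := by field_simp
    _ ≤ (K * L) / (1 - a) * max 1 (1 / (w * p)) := by gcongr; exact le_max_right _ _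
    _ = _ := by ring

end

lemma half_pow_le_prod {m n : ℕ} (h : 2 * m ≤ n) :
    ((n : ℝ) / 2) ^ (m - 1) ≤ ∏ j ∈ Finset.Icc 1 (m - 1), ((n : ℝ) - (j : ℝ)) := by
  have hc : ((n : ℝ) / 2) ^ (m - 1) = ∏ _j ∈ Finset.Icc 1 (m - 1), ((n : ℝ) / 2) := by
    rw [Finset.prod_const, Nat.card_Icc, Nat.add_sub_cancel]
  rw [hc]
  refine Finset.prod_le_prod (fun _ _ => by positivity) fun j hj => ?_
  have hj' := Finset.mem_Icc.1 hj
  have : 2 * j ≤ n := by omega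
  have : (2 : ℝ) * j ≤ n := by exact_mod_cast this
  linarith

lemma one_add_pow_choose_le {m k : ℕ} {χ δ y : ℝ} (hχ : 0 ≤ χ) (hδ : 0 < δ) (hy : (k : ℝ) ≤ y)
    (h : χ * y ^ m ≤ Real.log (1 + δ)) : (1 + χ) ^ k.choose m ≤ 1 + δ := by
  calc (1 + χ) ^ k.choose m ≤ Real.exp χ ^ k.choose m := by
        gcongr; linarith [Real.add_one_le_exp χ]
    _ = Real.exp ((k.choose m : ℝ) * χ) := (Real.exp_nat_mul _ _).symm
    _ ≤ Real.exp (Real.log (1 + δ)) := by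
        refine Real.exp_le_exp.2 (le_trans ?_ h)
        rw [mul_comm]
        refine mul_le_mul_of_nonneg_left ?_ hχ
        calc (k.choose m : ℝ) ≤ (k : ℝ) ^ m := by exact_mod_cast Nat.choose_le_pow k m
          _ ≤ y ^ m := by gcongr
    _ = 1 + δ := Real.exp_log (by linarith)

/-- The Poisson-type scale of the signal is bounded by `log (N / n)`. -/
lemma eventually_pow_mul_bernoulliKL_le {m : ℕ} {N n : ℕ → ℕ} {D : ℕ → ℝ} {ε : ℝ}
    (hε : 0 ≤ ε) (hn : ∀ k, 0 < n k ∧ n k < N k) (hD : ∀ k, 0 ≤ D k)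
    (hninf : Tendsto n atTop atTop)
    (hscan : ∀ᶠ k in atTop, (∏ j ∈ Finset.Icc 1 (m - 1), ((n k : ℝ) - (j : ℝ))) * D k ≤
      m.factorial * ((1 - ε) * Real.log ((N k : ℝ) / n k))) :
    ∀ᶠ k in atTop, (n k : ℝ) ^ (m - 1) * D k ≤
      2 ^ (m - 1) * m.factorial * Real.log ((N k : ℝ) / n k) := by
  filter_upwards [hscan, hninf.eventually_ge_atTop (2 * m)] with k hk hnk
  have hn' : (0 : ℝ) < n k := by exact_mod_cast (hn k).1
  have hL : 0 < Real.log ((N k : ℝ) / n k) :=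
    Real.log_pos ((one_lt_div hn').2 (by exact_mod_cast (hn k).2))
  have h1 := mul_le_mul_of_nonneg_right (half_pow_le_prod hnk) (hD k)
  calc (n k : ℝ) ^ (m - 1) * D k = 2 ^ (m - 1) * (((n k : ℝ) / 2) ^ (m - 1) * D k) := by
        rw [div_pow]; field_simp
    _ ≤ 2 ^ (m - 1) * (m.factorial * ((1 - ε) * Real.log ((N k : ℝ) / n k))) := by
        exact mul_le_mul_of_nonneg_left (h1.trans hk) (by positivity)
    _ ≤ 2 ^ (m - 1) * (m.factorial * (1 * Real.log ((N k : ℝ) / n k))) := by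
        gcongr; linarith
    _ = _ := by ring

/-- If p ≤ a and q > (1 + a)/2, then q/p is bounded away from 1 and the divergence has a fixed
positive lower bound. -/
lemma eventually_le_of_bernoulliKL_tendsto {p q : ℕ → ℝ} {a : ℝ} (ha0 : 0 < a) (ha : a < 1)
    (hp : ∀ k, 0 < p k ∧ p k < q k ∧ q k < 1) (hpa : ∀ᶠ k in atTop, p k ≤ a)
    (hD : Tendsto (fun k => bernoulliKL (p k) (q k)) atTop (𝓝 0)) :
    ∀ᶠ k in atTop, q k ≤ (1 + a) / 2 := by
  set u := Real.log ((1 + a) / 2 / a) with hu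
  have hu0 : 0 < u := Real.log_pos ((one_lt_div ha0).2 (by linarith))
  have hd : 0 < (1 + a) / 2 * (u * min 1 u) / 4 := by
    have : 0 < min 1 u := lt_min one_pos hu0
    positivity
  filter_upwards [hpa, hD.eventually_lt_const hd] with k hk hk2
  by_contra hcon
  push Not at hcon
  obtain ⟨h0, h01, h1⟩ := hp k
  have h3 := mul_log_ratio_mul_min_le_bernoulliKL h0 h01 h1
  have h4 : u ≤ Real.log (q k / p k) := by
    refine Real.log_le_log (by positivity) ?_
    exact div_le_div₀ (h0.trans h01).le hcon.le h0 hk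
  have h5 : (1 + a) / 2 * (u * min 1 u) ≤
      q k * (Real.log (q k / p k) * min 1 (Real.log (q k / p k))) := by
    have h6 : 0 < min 1 u := lt_min one_pos hu0
    refine mul_le_mul hcon.le ?_ (by positivity) (h0.trans h01).le
    exact mul_le_mul h4 (min_le_min le_rfl h4) h6.le (hu0.le.trans h4)
  linarith

/-- In the undetectable region, the risk of every test is eventually at least `1 - c`. -/
lemma eventually_forall_risk_ge (m : ℕ) (hm : 2 ≤ m)
    (N n : ℕ → ℕ) (p₀ p₁ : ℕ → unitInterval)
    (hN : Tendsto N atTop atTop)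
    (hn : ∀ k, 0 < n k ∧ n k < N k)
    (hp : ∀ k, 0 < p₀ k ∧ p₀ k < p₁ k ∧ p₁ k < 1)
    (hp₀ : ∃ c : ℝ, c < 1 ∧ ∀ᶠ k in atTop, (p₀ k : ℝ) ≤ c)
    (hrate₁ : Tendsto (fun k => Real.log (N k) / (n k : ℝ) ^ (m - 1)) atTop (𝓝 0))
    (hrate₂ : (fun k => Real.log (max 1 (1 / ((n k : ℝ) ^ (m - 1) * (p₀ k : ℝ)))))
      =o[atTop] fun k => Real.log ((N k : ℝ) / (n k : ℝ)))
    (hdeg : Tendsto (fun k => ((p₁ k : ℝ) - (p₀ k : ℝ)) / Real.sqrt (p₀ k : ℝ) *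
      ((n k : ℝ) ^ 2 / (N k : ℝ)) ^ ((m : ℝ) / 2)) atTop (𝓝 0))
    (hscan : limsup (fun k => (((∏ j ∈ Finset.Icc 1 (m - 1), ((n k : ℝ) - (j : ℝ))) *
      bernoulliKL (p₀ k) (p₁ k) /
        ((m.factorial : ℝ) * Real.log ((N k : ℝ) / (n k : ℝ))) : ℝ) : EReal)) atTop < 1)
    {c : ℝ} (hc : 0 < c) :
    ∀ᶠ k in atTop, ∀ T : Test m (N k), 1 - c ≤ risk m (N k) (n k) (p₀ k) (p₁ k) T := by
  have hp' : ∀ k, 0 < (p₀ k : ℝ) ∧ (p₀ k : ℝ) < p₁ k ∧ (p₁ k : ℝ) < 1 := hp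
  have hn' : ∀ k, (0 : ℝ) < n k := fun k => by exact_mod_cast (hn k).1
  have hN' : ∀ k, (0 : ℝ) < N k := fun k => by exact_mod_cast (hn k).1.trans (hn k).2
  have hL : ∀ k, 0 < Real.log ((N k : ℝ) / n k) := fun k =>
    Real.log_pos ((one_lt_div (hn' k)).2 (by exact_mod_cast (hn k).2))
  have hD0 : ∀ k, 0 ≤ bernoulliKL (p₀ k) (p₁ k) := fun k =>
    bernoulliKL_nonneg (hp' k).1 (hp' k).2.1 (hp' k).2.2
  obtain ⟨a, ha0, ha1, hpa⟩ : ∃ a : ℝ, 0 < a ∧ a < 1 ∧ ∀ᶠ k in atTop, (p₀ k : ℝ) ≤ a := by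
    obtain ⟨c₀, h1, h2⟩ := hp₀
    exact ⟨max c₀ (1 / 2), lt_max_of_lt_right (by norm_num), max_lt h1 (by norm_num),
      h2.mono fun k hk => hk.trans (le_max_left _ _)⟩
  obtain ⟨ε, hε0, hε1, hε⟩ : ∃ ε : ℝ, 0 < ε ∧ ε ≤ 1 ∧ ∀ᶠ k in atTop,
      (∏ j ∈ Finset.Icc 1 (m - 1), ((n k : ℝ) - (j : ℝ))) * bernoulliKL (p₀ k) (p₁ k) ≤
      m.factorial * ((1 - ε) * Real.log ((N k : ℝ) / n k)) := by
    obtain ⟨y, hy1, hy2⟩ := EReal.lt_iff_exists_real_btwn.1 hscan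
    have hy3 : y < 1 := by exact_mod_cast hy2
    -- The separating value `y` may be negative; clipping it at 0 ensures ε ≤ 1.
    refine ⟨1 - max y 0, by linarith [max_lt hy3 one_pos], by linarith [le_max_right y 0], ?_⟩
    filter_upwards [eventually_lt_of_limsup_lt hy1] with k hk
    have hk' := EReal.coe_lt_coe_iff.1 hk
    have hf : (0 : ℝ) < (m.factorial : ℝ) := by exact_mod_cast m.factorial_pos
    rw [div_lt_iff₀ (mul_pos hf (hL k))] at hk'
    have := mul_le_mul_of_nonneg_right (le_max_left y 0) (mul_pos hf (hL k)).le
    linarith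
  have hninf : Tendsto n atTop atTop := by
    refine tendsto_atTop.2 fun b => ?_
    have hlogN : Tendsto (fun k => Real.log (N k)) atTop atTop :=
      Real.tendsto_log_atTop.comp (tendsto_natCast_atTop_atTop.comp hN)
    filter_upwards [hrate₁.eventually_lt_const one_pos,
      hlogN.eventually_ge_atTop ((b : ℝ) ^ (m - 1))] with k hk1 hk2
    rw [div_lt_one (pow_pos (hn' k) _)] at hk1
    have := lt_of_pow_lt_pow_left₀ (m - 1) (hn' k).le (hk2.trans_lt hk1)
    exact_mod_cast this.le
  set K₀ : ℝ := 2 ^ (m - 1) * m.factorial with hK₀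
  have hK₀pos : 0 < K₀ := by
    have hf : (0 : ℝ) < (m.factorial : ℝ) := by exact_mod_cast m.factorial_pos
    positivity
  have hKL := eventually_pow_mul_bernoulliKL_le hε0.le hn hD0 hninf hε
  have hDlim : Tendsto (fun k => bernoulliKL (p₀ k) (p₁ k)) atTop (𝓝 0) := by
    have h1 : Tendsto (fun k => K₀ * (Real.log (N k) / (n k : ℝ) ^ (m - 1))) atTop (𝓝 0) := by
      simpa using hrate₁.const_mul K₀
    refine tendsto_of_tendsto_of_tendsto_of_le_of_le' tendsto_const_nhds h1
      (Eventually.of_forall hD0) ?_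
    filter_upwards [hKL] with k hk
    rw [← mul_div_assoc, le_div_iff₀ (pow_pos (hn' k) _), mul_comm]
    refine hk.trans (mul_le_mul_of_nonneg_left ?_ hK₀pos.le)
    refine Real.log_le_log (div_pos (hN' k) (hn' k)) (div_le_self (hN' k).le ?_)
    exact_mod_cast (hn k).1
  have hp1 := eventually_le_of_bernoulliKL_tendsto ha0 ha1 hp' hpa hDlim
  set a₁ := (1 + a) / 2 with ha₁
  have ha₁1 : a₁ < 1 := by rw [ha₁]; linarith
  set K : ℝ := 4 * (1 + 1 / (1 - a₁)) ^ 2 * K₀ with hKdef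
  have hKpos : 0 < K := by
    have : 0 < 1 - a₁ := by linarith
    positivity
  have hK : ∀ᶠ k in atTop, (n k : ℝ) ^ (m - 1) * ((p₁ k : ℝ) *
      (logOddsRatio (p₀ k) (p₁ k) * min 1 (logOddsRatio (p₀ k) (p₁ k)))) ≤
      K * Real.log ((N k : ℝ) / n k) := by
    filter_upwards [hKL, hp1] with k hk hk1
    have := mul_logOddsRatio_mul_min_le (hp' k).1 (hp' k).2.1 (hp' k).2.2 ha₁1 hk1
    calc _ ≤ (n k : ℝ) ^ (m - 1) * (4 * (1 + 1 / (1 - a₁)) ^ 2 * bernoulliKL (p₀ k) (p₁ k)) := by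
          gcongr
      _ = 4 * (1 + 1 / (1 - a₁)) ^ 2 * ((n k : ℝ) ^ (m - 1) * bernoulliKL (p₀ k) (p₁ k)) := by
          ring
      _ ≤ 4 * (1 + 1 / (1 - a₁)) ^ 2 * (K₀ * Real.log ((N k : ℝ) / n k)) := by gcongr
      _ = _ := by rw [hKdef]; ring
  have hχ0 : ∀ k, 0 ≤ ((p₁ k : ℝ) - p₀ k) ^ 2 / (p₀ k * (1 - p₀ k)) := fun k =>
    div_nonneg (sq_nonneg _) (mul_nonneg (hp' k).1.le (by linarith [(hp' k).2.1, (hp' k).2.2]))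
  have hdegχ : ∀ A : ℝ, 0 < A → ∀ η : ℝ, 0 < η → ∀ᶠ k in atTop,
      ((p₁ k : ℝ) - p₀ k) ^ 2 / (p₀ k * (1 - p₀ k)) * (A * ((n k : ℝ) ^ 2 / N k)) ^ m ≤ η := by
    intro A hA η hη
    have h1 := ((hdeg.pow 2).const_mul (A ^ m / (1 - a)))
    simp only [ne_eq, OfNat.ofNat_ne_zero, not_false_eq_true, zero_pow, mul_zero] at h1
    filter_upwards [h1.eventually_lt_const hη, hpa] with k hk hka
    refine le_trans ?_ hk.le
    have hy : 0 ≤ (n k : ℝ) ^ 2 / N k := by positivity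
    have e1 : (((n k : ℝ) ^ 2 / (N k : ℝ)) ^ ((m : ℝ) / 2)) ^ 2 =
        ((n k : ℝ) ^ 2 / (N k : ℝ)) ^ m := by
      rw [← Real.rpow_mul_natCast hy]
      norm_num
    rw [mul_pow _ _ 2, e1, div_pow, Real.sq_sqrt (hp' k).1.le, mul_pow, ← div_div]
    have h2 : 0 < 1 - a := by linarith
    have h3 : 0 < (p₀ k : ℝ) := (hp' k).1
    calc ((p₁ k : ℝ) - p₀ k) ^ 2 / p₀ k / (1 - p₀ k) * (A ^ m * ((n k : ℝ) ^ 2 / N k) ^ m)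
        ≤ ((p₁ k : ℝ) - p₀ k) ^ 2 / p₀ k / (1 - a) * (A ^ m * ((n k : ℝ) ^ 2 / N k) ^ m) := by
          gcongr
      _ = _ := by ring
  set δ : ℝ := c ^ 2 / 2 with hδ
  have hδ0 : 0 < δ := by positivity
  obtain ⟨M, hM1, hM⟩ : ∃ M : ℝ, 1 ≤ M ∧ 6 * Real.exp (-M) ≤ c ^ 2 / 2 := by
    have h1 : Tendsto (fun M : ℝ => 6 * Real.exp (-M)) atTop (𝓝 0) := by
      simpa using (Real.tendsto_exp_neg_atTop_nhds_zero).const_mul 6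
    obtain ⟨M, h2, h3⟩ := ((h1.eventually_lt_const hδ0).and (eventually_ge_atTop 1)).exists
    exact ⟨M, h3, h2.le⟩
  -- The constants come in the order M from c, b from ε and K, κ from ε, b and M, and finally the
  -- threshold L₀, all independent of the index.
  set b : ℝ := min (1 / 2) (ε / (16 * K)) with hb
  have hb0 : 0 < b := lt_min (by norm_num) (by positivity)
  have hKb : 16 * K * b ≤ ε := by
    have := min_le_right (1 / 2) (ε / (16 * K))
    rw [← hb, le_div_iff₀ (by positivity)] at this
    linarith
  set κ : ℝ := min (ε / 8) (b * ε / (4 * (M + 1))) with hκ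
  have hκ0 : 0 < κ := lt_min (by positivity) (by positivity)
  have hκM : κ * (M + 1) ≤ b * ε / 4 := by
    have := min_le_right (ε / 8) (b * ε / (4 * (M + 1)))
    rw [← hκ, le_div_iff₀ (by positivity)] at this
    linarith
  set K' : ℝ := K / (1 - a) with hK'
  have hK'0 : 0 < K' := div_pos hKpos (by linarith)
  obtain ⟨L₀, hL₀⟩ : ∃ L₀ : ℝ, ∀ L ≥ L₀, 1 ≤ κ * L ∧ Real.log (K / (1 - a₁) * L) ≤ κ / 2 * L ∧
      K' * L * Real.exp (-(ε / 8 * L)) ≤ 1 ∧ M + 1 ≤ ε / 4 * L := by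
    refine eventually_atTop.1 ?_
    have hC : 0 < K / (1 - a₁) := div_pos hKpos (by linarith)
    have e1 : ∀ᶠ L : ℝ in atTop, 1 ≤ κ * L :=
      (tendsto_id.const_mul_atTop hκ0).eventually_ge_atTop 1
    have e2 : ∀ᶠ L : ℝ in atTop, Real.log (K / (1 - a₁) * L) ≤ κ / 2 * L := by
      have hη : 0 < κ / 2 / (K / (1 - a₁)) := by positivity
      have h1 := (Real.isLittleO_log_id_atTop.bound hη)
      have h2 : Tendsto (fun L : ℝ => K / (1 - a₁) * L) atTop atTop :=
        tendsto_id.const_mul_atTop hC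
      filter_upwards [h2.eventually h1, eventually_ge_atTop 0] with L hL hL0
      refine (le_abs_self _).trans (hL.trans_eq ?_)
      rw [id, Real.norm_of_nonneg (by positivity), ← mul_assoc, div_mul_cancel₀ _ hC.ne']
    have e3 : ∀ᶠ L : ℝ in atTop, K' * L * Real.exp (-(ε / 8 * L)) ≤ 1 := by
      have h1 : Tendsto (fun x : ℝ => K' / (ε / 8) * (x * Real.exp (-x))) atTop (𝓝 0) := by
        have := Real.tendsto_pow_mul_exp_neg_atTop_nhds_zero 1
        simp only [pow_one] at this
        simpa using this.const_mul (K' / (ε / 8))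
      have h2 : Tendsto (fun L : ℝ => ε / 8 * L) atTop atTop :=
        tendsto_id.const_mul_atTop (by positivity)
      filter_upwards [h2.eventually (h1.eventually_lt_const one_pos)] with L hL
      refine le_trans (le_of_eq ?_) hL.le
      field_simp
    have e4 : ∀ᶠ L : ℝ in atTop, M + 1 ≤ ε / 4 * L :=
      (tendsto_id.const_mul_atTop (by positivity : 0 < ε / 4)).eventually_ge_atTop (M + 1)
    filter_upwards [e1, e2, e3, e4] with L h1 h2 h3 h4
    exact ⟨h1, h2, h3, h4⟩
  have hlog : 0 < Real.log (1 + δ) := Real.log_pos (by linarith)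
  have hrate₂' := hrate₂.bound (half_pos hκ0)
  filter_upwards [hpa, hε, hp1, hK, hrate₂', hdegχ _ (Real.exp_pos (M + 2)) _ hlog,
    hdegχ _ (Real.exp_pos L₀) _ hlog] with k hpak hεk hp1k hKk hrk hdk hdk' T
  obtain ⟨h0, h01, h1⟩ := hp' k
  set L := Real.log ((N k : ℝ) / n k) with hLdef
  -- The split is made at each index, so no subsequences are needed. If L < L₀, every overlap is at
  -- most n ≤ exp(L₀) n²/N.
  rcases lt_or_ge L L₀ with hcase | hcase
  · refine risk_ge_of_second_moment h0 h01 h1 (hn k).2.le hc (fun j hj => ?_) T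
    have hj' : (j : ℝ) ≤ Real.exp L₀ * ((n k : ℝ) ^ 2 / N k) := by
      have h5 : (N k : ℝ) / n k ≤ Real.exp L₀ :=
        (Real.log_le_iff_le_exp (div_pos (hN' k) (hn' k))).1 hcase.le
      calc (j : ℝ) ≤ n k := by exact_mod_cast hj
        _ = (N k : ℝ) / n k * ((n k : ℝ) ^ 2 / N k) := by
            have := hn' k
            have := hN' k
            field_simp
        _ ≤ _ := by gcongr
    refine (one_add_pow_choose_le (hχ0 k) hδ0 hj' hdk').trans ?_
    have : 0 < c ^ 2 := by positivity
    rw [hδ]; linarith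
  · obtain ⟨hκL, hlogL, hK'L, hML⟩ := hL₀ L hcase
    have hθκ : logOddsRatio (p₀ k) (p₁ k) ≤ κ * L := by
      rcases le_total (logOddsRatio (p₀ k) (p₁ k)) 1 with h | h
      · exact h.trans hκL
      · have h6 := logOddsRatio_le_log_add_log h0 h01 h1 ha₁1 hp1k
          (pow_pos (hn' k) (m - 1)) (hL k) hKpos h hKk
        have h7 : Real.log (max 1 (1 / ((n k : ℝ) ^ (m - 1) * (p₀ k : ℝ)))) ≤ κ / 2 * L := by
          refine (le_abs_self _).trans (hrk.trans_eq ?_)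
          rw [Real.norm_of_nonneg (hL k).le]
        linarith
    have hχ : (n k : ℝ) ^ (m - 1) * (((p₁ k : ℝ) - p₀ k) ^ 2 / (p₀ k * (1 - p₀ k))) ≤
        K' * L * Real.exp (logOddsRatio (p₀ k) (p₁ k)) := by
      have h8 : 0 < 1 - a := by linarith
      calc _ ≤ (n k : ℝ) ^ (m - 1) * ((p₁ k : ℝ) * (logOddsRatio (p₀ k) (p₁ k) *
            min 1 (logOddsRatio (p₀ k) (p₁ k))) * Real.exp (logOddsRatio (p₀ k) (p₁ k)) /
            (1 - p₀ k)) := by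
            exact mul_le_mul_of_nonneg_left (chi_sq_le h0 h01 h1) (pow_pos (hn' k) _).le
        _ = ((n k : ℝ) ^ (m - 1) * ((p₁ k : ℝ) * (logOddsRatio (p₀ k) (p₁ k) *
            min 1 (logOddsRatio (p₀ k) (p₁ k))))) * Real.exp (logOddsRatio (p₀ k) (p₁ k)) /
            (1 - p₀ k) := by ring
        _ ≤ (K * L) * Real.exp (logOddsRatio (p₀ k) (p₁ k)) / (1 - a) := by
            have : 0 ≤ K * L := mul_nonneg hKpos.le (hL k).le
            gcongr
        _ = _ := by rw [hK']; ring
    exact risk_ge_of_large_ratio hm (hn k).1 (hn k).2 h0 h01 h1 hLdef hb0 (min_le_left _ _) hκ0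
      hM1 hε1 hεk hKk hχ (hD0 k) hθκ hκL hKb hκM (min_le_left _ _) hK'0.le hK'L hML hc hδ0.le
      (by linarith) (fun j _ hj => one_add_pow_choose_le (hχ0 k) hδ0 hj hdk) T

end Asymptotics

end DenseSubhypergraph

end

theorem theorem2 (m : ℕ) (hm : 2 ≤ m)
    (N n : ℕ → ℕ) (p₀ p₁ : ℕ → unitInterval)
    (hN : Tendsto N atTop atTop)
    (hn : ∀ k, 0 < n k ∧ n k < N k)
    (hp : ∀ k, 0 < p₀ k ∧ p₀ k < p₁ k ∧ p₁ k < 1)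
    -- the null edge probability stays away from one
    (hp₀ : ∃ c : ℝ, c < 1 ∧ ∀ᶠ k in atTop, (p₀ k : ℝ) ≤ c)
    -- the rate conditions
    (hrate₁ : Tendsto (fun k => Real.log (N k) / (n k : ℝ) ^ (m - 1)) atTop (𝓝 0))
    (hrate₂ : (fun k => Real.log (max 1 (1 / ((n k : ℝ) ^ (m - 1) * (p₀ k : ℝ)))))
      =o[atTop] fun k => Real.log ((N k : ℝ) / (n k : ℝ)))
    -- the two conditions that define the undetectable region
    (hdeg : Tendsto (fun k => ((p₁ k : ℝ) - (p₀ k : ℝ)) / Real.sqrt (p₀ k : ℝ) *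
      ((n k : ℝ) ^ 2 / (N k : ℝ)) ^ ((m : ℝ) / 2)) atTop (𝓝 0))
    (hscan : limsup (fun k => (((∏ j ∈ Finset.Icc 1 (m - 1), ((n k : ℝ) - (j : ℝ))) *
      DenseSubhypergraph.bernoulliKL (p₀ k) (p₁ k) /
        ((m.factorial : ℝ) * Real.log ((N k : ℝ) / (n k : ℝ))) : ℝ) : EReal)) atTop < 1) :
    -- the smallest risk that a test can achieve tends to one
    Tendsto (fun k => ⨅ T : DenseSubhypergraph.Test m (N k),
      DenseSubhypergraph.risk m (N k) (n k) (p₀ k) (p₁ k) T) atTop (𝓝 1) ∧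
    -- every sequence of tests has asymptotic risk at least one
    (∀ T : (k : ℕ) → DenseSubhypergraph.Test m (N k), ∀ ε : ℝ, 0 < ε →
      ∀ᶠ k in atTop,
        1 - ε < DenseSubhypergraph.risk m (N k) (n k) (p₀ k) (p₁ k) (T k)) ∧
    -- the risk tends to one unless the tests are worse than the trivial test
    (∀ T : (k : ℕ) → DenseSubhypergraph.Test m (N k),
      (∀ᶠ k in atTop, DenseSubhypergraph.risk m (N k) (n k) (p₀ k) (p₁ k) (T k) ≤ 1) →
      Tendsto (fun k => DenseSubhypergraph.risk m (N k) (n k) (p₀ k) (p₁ k) (T k))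
        atTop (𝓝 1)) := by
  have hmain := fun {c : ℝ} (hc : 0 < c) => DenseSubhypergraph.eventually_forall_risk_ge m hm N n
    p₀ p₁ hN hn hp hp₀ hrate₁ hrate₂ hdeg hscan hc
  have htrivial : ∀ k, DenseSubhypergraph.risk m (N k) (n k) (p₀ k) (p₁ k) (fun _ => false) = 1 :=
    fun k => DenseSubhypergraph.risk_const_false (hn k).2.le (p₀ k) (p₁ k)
  have htendsto : ∀ r : ℕ → ℝ, (∀ᶠ k in atTop, r k ≤ 1) →
      (∀ c : ℝ, 0 < c → ∀ᶠ k in atTop, 1 - c ≤ r k) → Tendsto r atTop (𝓝 1) := by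
    intro r hr h
    refine tendsto_order.2 ⟨fun x hx => ?_, fun x hx => hr.mono fun k hk => hk.trans_lt hx⟩
    filter_upwards [h ((1 - x) / 2) (by linarith)] with k hk
    linarith
  refine ⟨htendsto _ (Eventually.of_forall fun k => ?_) fun c hc => ?_, fun T ε hε => ?_,
    fun T hT => htendsto _ hT fun c hc => ?_⟩
  · rw [← htrivial k]
    exact ciInf_le (Set.finite_range _).bddBelow _
  · filter_upwards [hmain hc] with k hk
    exact le_ciInf hk
  · filter_upwards [hmain (half_pos hε)] with k hk
    linarith [hk (T k)]
  · filter_upwards [hmain hc] with k hk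
    exact hk (T k)
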